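/- Let $k>1$, $c>0$, $R>0$ and consider the highly nonlinear wave equation $$\tilde u_{tt}=F,\qquad F=c^2\Big(\tilde u_x^{k-1}\tilde u_{xx}+\alpha\,\tilde u_x^{k-3}\tilde u_{xx}^3+\beta\,\tilde u_x^{k-2}\tilde u_{xx}\tilde u_{xxx}+\gamma\,\tilde u_x^{k-1}\tilde u_{xxxx}\Big),$$ $$\alpha=\tfrac16(k-1)(k-2)R^2,\quad \beta=\tfrac23(k-1)R^2,\quad \gamma=\tfrac13R^2,$$ for functions $\tilde u(t,x)$ of positive strain $\tilde u_x>0$. Let $D_t,D_x$ denote total derivatives. Let $U$ be a nonempty connected open subset of $\{(t,x,\tilde u,\tilde u_x,\tilde u_t)\in\mathbb R^5:\tilde u_x>0\}$ (for instance all of it). A smooth function $Q(t,x,\tilde u,\tilde u_x,\tilde u_t)$ on $U$ is called a first-order multiplier if there are smooth functions $T,X$ of $t$, $x$, $\tilde u$ and finitely many partial derivatives of $\tilde u$ such that $$D_tT+D_xX=(\tilde u_{tt}-F)\,Q$$ holds identically for all smooth functions $\tilde u$ (not only solutions), defined on an open region of the $(t,x)$-plane, whose first-order jets $(t,x,\tilde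 u,\tilde u_x,\tilde u_t)$ lie in $U$. **(i)** The first-order multipliers on $U$ are exactly the linear combinations, with constant real coefficients, of the linearly independent functions $$Q_1=1,\qquad Q_2=t,\qquad Q_3=-\tilde u_x,\qquad Q_4=\tilde u_t .$$ **(ii)** Corresponding densities and fluxes are $$\begin{aligned} T_1&=\tilde u_t, & X_1&=-c^2\big(\tfrac13R^2\tilde u_x^{k-1}\tilde u_{xxx}+\tfrac{k-1}6R^2\tilde u_x^{k-2}\tilde u_{xx}^2+\tfrac1k\tilde u_x^k\big),\\ T_2&=t\tilde u_t-\tilde u, & X_2&=t\,X_1,\\ T_3&=-\tilde u_t\tilde u_x, & X_3&=\tfrac12\tilde u_t^2+c^2\big(\tfrac13R^2\tilde u_x^{k}\tilde u_{xxx}+\tfrac{k-2}6R^2\tilde u_x^{k-1}\tilde u_{xx}^2+\tfrac1{k+1}\tilde u_x^{k+1}\big),\\ T_4&=\tfrac12\tilde u_t^2-c^2\big(\tfrac16R^2\tilde u_x^{k-1}\tilde u_{xx}^2-\tfrac1{k(k+1)}\tilde u_x^{k+1}\big),\\ & & X_4&=-c^2\big(\tfrac13R^2\tilde u_x^{k-1}(\tilde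 u_t\tilde u_{xxx}-\tilde u_{tx}\tilde u_{xx})+\tfrac{k-1}6R^2\tilde u_x^{k-2}\tilde u_t\tilde u_{xx}^2+\tfrac1k\tilde u_x^k\tilde u_t\big), \end{aligned}$$ that is, for $i=1,\dots,4$ one has $Q_i=\partial T_i/\partial\tilde u_t$ and $D_tT_i+D_xX_i=(\tilde u_{tt}-F)Q_i$ for all smooth $\tilde u$ with $\tilde u_x>0$ on an open region of the $(t,x)$-plane. Hence every smooth solution with $\tilde u_x>0$ on an open region satisfies $D_tT_i+D_xX_i=0$ there, and $\frac{d}{dt}\int_a^bT_i\,dx=-X_i\big|_{x=a}^{x=b}$ at each time $t$ for which $\{t\}\times[a,b]$ lies in the region. The four densities are those of mean longitudinal momentum ($T_1$), its time-weighted analogue ($T_2$), total momentum ($T_3$) and energy ($T_4$). **(iii)** $T_4$ is the Hamiltonian density: with $v=\tilde u_x$, $w=-\tilde u_t$ and $H=\tfrac12w^2+c^2\big(\tfrac1{k(k+1)}v^{k+1}-\tfrac16R^2v^{k-1}v_x^2\big)$ one has $T_4=H$, and for every smooth $\tilde u$ with $\tilde u_x>0$ on an open region the wave equation holds at a point of the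 region if and only if Hamilton's equations $v_t=-D_x(\delta H/\delta w)$, $w_t=-D_x(\delta H/\delta v)$ hold there. -/

import Mathlib

open scoped ContDiff

noncomputable section

namespace HNWave

/-- The partial derivative `∂ₜⁱ ∂ₓʲ u` at `(t, x)` of a function `u = u(t, x)`. -/
def pd (i j : ℕ) (u : ℝ → ℝ → ℝ) (t x : ℝ) : ℝ :=
  iteratedDeriv i (fun s => iteratedDeriv j (fun y => u s y) x) t

/-- Total time derivative along `u` of a quantity already evaluated on `u`. -/
def Dt (f : ℝ → ℝ → ℝ) (t x : ℝ) : ℝ := deriv (fun s => f s x) t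

/-- Total space derivative along `u` of a quantity already evaluated on `u`. -/
def Dx (f : ℝ → ℝ → ℝ) (t x : ℝ) : ℝ := deriv (fun y => f t y) x

/-- The right-hand side `F` of the wave equation `u_tt = F(u_x, u_xx, u_xxx, u_xxxx)`;
`p, r, s, y` stand for `u_x, u_xx, u_xxx, u_xxxx`. -/
def waveF (k c R p r s y : ℝ) : ℝ :=
  c ^ 2 * (p ^ (k - 1) * r
    + (1 / 6 * (k - 1) * (k - 2) * R ^ 2) * p ^ (k - 3) * r ^ 3
    + (2 / 3 * (k - 1) * R ^ 2) * p ^ (k - 2) * r * s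
    + (1 / 3 * R ^ 2) * p ^ (k - 1) * y)

/-- The expression `u_tt - F` evaluated on a function `u` at `(t, x)`. -/
def waveOp (k c R : ℝ) (u : ℝ → ℝ → ℝ) (t x : ℝ) : ℝ :=
  pd 2 0 u t x - waveF k c R (pd 0 1 u t x) (pd 0 2 u t x) (pd 0 3 u t x) (pd 0 4 u t x)

/-- The space of first-order jets, with coordinates `(t, x, u, u_x, u_t)`. -/
abbrev FirstJet := ℝ × ℝ × ℝ × ℝ × ℝ

/-- The first-order jet of `u` at `(t, x)`. -/
def firstJet (u : ℝ → ℝ → ℝ) (t x : ℝ) : FirstJet :=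
  (t, x, u t x, pd 0 1 u t x, pd 1 0 u t x)

/-- The region of positive strain `u_x > 0`. -/
def posStrain : Set FirstJet := {z | 0 < z.2.2.2.1}

/-- Jets `(t, x, (∂ₜⁱ ∂ₓʲ u)_{i, j ≤ N + 1})`; as `N` varies these exhaust the jets of all
finite orders. -/
abbrev Jet (N : ℕ) := ℝ × ℝ × (Fin (N + 2) → Fin (N + 2) → ℝ)

/-- The jet of `u` at `(t, x)`. -/
def jet (N : ℕ) (u : ℝ → ℝ → ℝ) (t x : ℝ) : Jet N :=
  (t, x, fun i j => pd (i : ℕ) (j : ℕ) u t x)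

/-- The jets whose first-order part lies in `U`. -/
def jetDomain (N : ℕ) (U : Set FirstJet) : Set (Jet N) :=
  {z | (z.1, z.2.1, z.2.2 0 0, z.2.2 0 1, z.2.2 1 0) ∈ U}

/-- `u` is a smooth function on the open space-time region `O` (a set of points `(t, x)`) all
of whose first-order jets lie in `U`. -/
def SmoothOn (U : Set FirstJet) (O : Set (ℝ × ℝ)) (u : ℝ → ℝ → ℝ) : Prop :=
  IsOpen O ∧ ContDiffOn ℝ ∞ (Function.uncurry u) O ∧
    ∀ t x : ℝ, (t, x) ∈ O → firstJet u t x ∈ U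

/-- A smooth function `Q(t, x, u, u_x, u_t)` on `U` is a first-order multiplier of `u_tt = F` if
`(u_tt - F) Q` is a total `t`-derivative plus a total `x`-derivative of smooth functions of
`t`, `x`, `u` and finitely many derivatives of `u`, identically for arbitrary functions `u`
(not only for solutions). -/
def IsMultiplier (k c R : ℝ) (U : Set FirstJet) (Q : FirstJet → ℝ) : Prop :=
  ContDiffOn ℝ ∞ Q U ∧
  ∃ (N : ℕ) (T X : Jet N → ℝ),
    ContDiffOn ℝ ∞ T (jetDomain N U) ∧ ContDiffOn ℝ ∞ X (jetDomain N U) ∧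
    ∀ (O : Set (ℝ × ℝ)) (u : ℝ → ℝ → ℝ), SmoothOn U O u → ∀ t x : ℝ, (t, x) ∈ O →
      Dt (fun s y => T (jet N u s y)) t x + Dx (fun s y => X (jet N u s y)) t x
        = waveOp k c R u t x * Q (firstJet u t x)

/-- The functions `Q₁ = 1`, `Q₂ = t`, `Q₃ = -u_x`, `Q₄ = u_t`. -/
def mult (i : Fin 4) (z : FirstJet) : ℝ :=
  ![1, z.1, -z.2.2.2.1, z.2.2.2.2] i

/-- The densities `T₁, …, T₄`; the arguments `u p r q` stand for `u, u_x, u_xx, u_t`. -/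
def density (k c R : ℝ) (i : Fin 4) (t u p r q : ℝ) : ℝ :=
  ![q,
    t * q - u,
    -(q * p),
    1 / 2 * q ^ 2
      - c ^ 2 * (1 / 6 * R ^ 2 * p ^ (k - 1) * r ^ 2 - 1 / (k * (k + 1)) * p ^ (k + 1))] i

/-- The fluxes `X₁, …, X₄`; the arguments `p r s q m` stand for
`u_x, u_xx, u_xxx, u_t, u_tx`. -/
def flux (k c R : ℝ) (i : Fin 4) (t p r s q m : ℝ) : ℝ :=
  ![-c ^ 2 * (1 / 3 * R ^ 2 * p ^ (k - 1) * s + (k - 1) / 6 * R ^ 2 * p ^ (k - 2) * r ^ 2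
      + 1 / k * p ^ k),
    -c ^ 2 * t * (1 / 3 * R ^ 2 * p ^ (k - 1) * s + (k - 1) / 6 * R ^ 2 * p ^ (k - 2) * r ^ 2
      + 1 / k * p ^ k),
    1 / 2 * q ^ 2 + c ^ 2 * (1 / 3 * R ^ 2 * p ^ k * s
      + (k - 2) / 6 * R ^ 2 * p ^ (k - 1) * r ^ 2 + 1 / (k + 1) * p ^ (k + 1)),
    -c ^ 2 * (1 / 3 * R ^ 2 * p ^ (k - 1) * (q * s - m * r)
      + (k - 1) / 6 * R ^ 2 * p ^ (k - 2) * q * r ^ 2 + 1 / k * p ^ k * q)] i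

/-- `Tᵢ` evaluated on `u`. -/
def densityOn (k c R : ℝ) (i : Fin 4) (u : ℝ → ℝ → ℝ) (t x : ℝ) : ℝ :=
  density k c R i t (u t x) (pd 0 1 u t x) (pd 0 2 u t x) (pd 1 0 u t x)

/-- `Xᵢ` evaluated on `u`. -/
def fluxOn (k c R : ℝ) (i : Fin 4) (u : ℝ → ℝ → ℝ) (t x : ℝ) : ℝ :=
  flux k c R i t (pd 0 1 u t x) (pd 0 2 u t x) (pd 0 3 u t x) (pd 1 0 u t x) (pd 1 1 u t x)

/-- The potential part `L₀(u_x, u_xx)` of the Lagrangian `L = u_t² / 2 + L₀`. -/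
def lagrangian₀ (k c R p r : ℝ) : ℝ :=
  c ^ 2 * (-1 / (k * (k + 1)) * p ^ (k + 1) + 1 / 6 * R ^ 2 * p ^ (k - 1) * r ^ 2)

/-- The Hamiltonian density `H = w² / 2 - L₀(v, v_x)`. -/
def hamiltonian (k c R w v vx : ℝ) : ℝ :=
  1 / 2 * w ^ 2 - lagrangian₀ k c R v vx

/-- The variational derivative `δH/δv = ∂H/∂v - D_x (∂H/∂v_x)` along functions `w, v`. -/
def deltaV (k c R : ℝ) (w v : ℝ → ℝ → ℝ) (t x : ℝ) : ℝ :=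
  deriv (fun a => hamiltonian k c R (w t x) a (Dx v t x)) (v t x)
    - Dx (fun s y => deriv (fun b => hamiltonian k c R (w s y) (v s y) b) (Dx v s y)) t x

/-- The variational derivative `δH/δw = ∂H/∂w` along functions `w, v`
(`H` contains no derivatives of `w`). -/
def deltaW (k c R : ℝ) (w v : ℝ → ℝ → ℝ) (t x : ℝ) : ℝ :=
  deriv (fun a => hamiltonian k c R a (v t x) (Dx v t x)) (w t x)

/-- Hamilton's equations `v_t = -D_x (δH/δw)`, `w_t = -D_x (δH/δv)` at `(t, x)`. -/
def HamiltonEqs (k c R : ℝ) (w v : ℝ → ℝ → ℝ) (t x : ℝ) : Prop :=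
  Dt v t x = -Dx (deltaW k c R w v) t x ∧ Dt w t x = -Dx (deltaV k c R w v) t x

end HNWave

end

open Set Filter Topology MeasureTheory

noncomputable section

namespace HNWave

/-! Write p = u_x, q = u_t, and Q_p, Q_tq, ... for partial derivatives of Q(t, x, u, p, q).

The listed functions are multipliers by a direct chain-rule computation,
`Dt_densityOn_add_Dx_fluxOn`. The integrated laws follow by differentiation under the integral sign,
and the Hamiltonian form from δH/δv = -X₁.

For the converse, the integral of a total divergence over a compact set does not change under a
perturbation of u supported there (`IsMultiplier.integral_eq`). Differentiating along u + eφ, moving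
all derivatives off φ and applying the fundamental lemma gives the determining equation
`IsMultiplier.euler_eq_zero`: D_t²Q - F'(u)Q + G Q_u - D_x(G Q_p) - D_t(G Q_q) = 0, where G = u_tt -
F. The linearization F'(u) reappears unchanged because F is the variational derivative of a
Lagrangian, so F'(u) is self-adjoint (`pair_linF`).

On polynomials u with prescribed u_xx = r, u_xxxx = y, u_tx = m, u_tt = h at a point, the equation
becomes an algebraic identity in these free parameters (`IsMultiplier.euler_testFun`). The
coefficient of h gives Q_qq = Q_pp = 0 and a first-order relation. The coefficient of y gives Q_pq =
0 and, after differentiations in jet coordinates and a division by k - 1, Q_x = p Q_xp and Q_tq -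
(k+1) Q_u - (k+2) Q_xp = 0. The part linear in r comes from the non-dispersive term of F and gives
the same relation with k in place of k + 2 (`IsMultiplier.coeff_uxx`). Hence Q_xp = 0, so Q_x = 0,
and then (k+3) Q_u = 0. The remaining equations kill Q_tt, Q_tp, Q_tq. All second derivatives vanish
on the connected set U, so Q is affine in t, p, q. -/

/-- A function of `(t, x)` that is smooth on the region `O`. -/
def Sm (O : Set (ℝ × ℝ)) (f : ℝ → ℝ → ℝ) : Prop := ContDiffOn ℝ ∞ (Function.uncurry f) O

/-! ### Partial and total derivatives of functions smooth on an open region -/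

section Calculus

variable {O : Set (ℝ × ℝ)} {f g : ℝ → ℝ → ℝ} {t x : ℝ}

theorem Sm.contDiffAt (hO : IsOpen O) (hf : Sm O f) (h : (t, x) ∈ O) :
    ContDiffAt ℝ ∞ (Function.uncurry f) (t, x) :=
  ContDiffOn.contDiffAt hf (hO.mem_nhds h)

theorem Sm.differentiableAt (hO : IsOpen O) (hf : Sm O f) (h : (t, x) ∈ O) :
    DifferentiableAt ℝ (Function.uncurry f) (t, x) :=
  (hf.contDiffAt hO h).differentiableAt (by simp)

theorem hasDerivAt_fst_of_differentiableAt
    (hf : DifferentiableAt ℝ (Function.uncurry f) (t, x)) :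
    HasDerivAt (fun s => f s x) (fderiv ℝ (Function.uncurry f) (t, x) (1, 0)) t :=
  hf.hasFDerivAt.comp_hasDerivAt t (f := fun s : ℝ => (s, x))
    ((hasDerivAt_id t).prodMk (hasDerivAt_const t x))

theorem hasDerivAt_snd_of_differentiableAt
    (hf : DifferentiableAt ℝ (Function.uncurry f) (t, x)) :
    HasDerivAt (fun y => f t y) (fderiv ℝ (Function.uncurry f) (t, x) (0, 1)) x :=
  hf.hasFDerivAt.comp_hasDerivAt x (f := fun y : ℝ => (t, y))
    ((hasDerivAt_const x t).prodMk (hasDerivAt_id x))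

theorem Sm.Dt_eq (hO : IsOpen O) (hf : Sm O f) (h : (t, x) ∈ O) :
    Dt f t x = fderiv ℝ (Function.uncurry f) (t, x) (1, 0) :=
  (hasDerivAt_fst_of_differentiableAt (hf.differentiableAt hO h)).deriv

theorem Sm.Dx_eq (hO : IsOpen O) (hf : Sm O f) (h : (t, x) ∈ O) :
    Dx f t x = fderiv ℝ (Function.uncurry f) (t, x) (0, 1) :=
  (hasDerivAt_snd_of_differentiableAt (hf.differentiableAt hO h)).deriv

theorem Sm.hasDerivAt_t (hO : IsOpen O) (hf : Sm O f) (h : (t, x) ∈ O) :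
    HasDerivAt (fun s => f s x) (Dt f t x) t := by
  rw [hf.Dt_eq hO h]; exact hasDerivAt_fst_of_differentiableAt (hf.differentiableAt hO h)

theorem Sm.hasDerivAt_x (hO : IsOpen O) (hf : Sm O f) (h : (t, x) ∈ O) :
    HasDerivAt (fun y => f t y) (Dx f t x) x := by
  rw [hf.Dx_eq hO h]; exact hasDerivAt_snd_of_differentiableAt (hf.differentiableAt hO h)

theorem contDiffOn_fderiv_apply {E : Type*} [NormedAddCommGroup E] [NormedSpace ℝ E] {U : Set E}
    (hU : IsOpen U) {A : E → ℝ} (hA : ContDiffOn ℝ ∞ A U) (v : E) :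
    ContDiffOn ℝ ∞ (fun z => fderiv ℝ A z v) U :=
  (hA.fderiv_of_isOpen hU (by simp)).clm_apply contDiffOn_const

theorem Sm.Dt (hO : IsOpen O) (hf : Sm O f) : Sm O (Dt f) :=
  (contDiffOn_fderiv_apply hO hf (1, 0)).congr fun _ hz => hf.Dt_eq hO hz

theorem Sm.Dx (hO : IsOpen O) (hf : Sm O f) : Sm O (Dx f) :=
  (contDiffOn_fderiv_apply hO hf (0, 1)).congr fun _ hz => hf.Dx_eq hO hz

theorem eventually_fst (hO : IsOpen O) (h : (t, x) ∈ O) : ∀ᶠ s in 𝓝 t, (s, x) ∈ O :=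
  (Continuous.continuousAt (by fun_prop : Continuous fun s : ℝ => (s, x))).eventually
    (hO.mem_nhds h)

theorem eventually_snd (hO : IsOpen O) (h : (t, x) ∈ O) : ∀ᶠ y in 𝓝 x, (t, y) ∈ O :=
  (Continuous.continuousAt (by fun_prop : Continuous fun y : ℝ => (t, y))).eventually
    (hO.mem_nhds h)

theorem Dt_congr (hO : IsOpen O) (hfg : ∀ s y, (s, y) ∈ O → f s y = g s y) (h : (t, x) ∈ O) :
    Dt f t x = Dt g t x :=
  Filter.EventuallyEq.deriv_eq ((eventually_fst hO h).mono fun s hs => hfg s x hs)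

theorem Dx_congr (hO : IsOpen O) (hfg : ∀ s y, (s, y) ∈ O → f s y = g s y) (h : (t, x) ∈ O) :
    Dx f t x = Dx g t x :=
  Filter.EventuallyEq.deriv_eq ((eventually_snd hO h).mono fun y hy => hfg t y hy)

theorem fderiv_fderiv_apply_comm {E : Type*} [NormedAddCommGroup E] [NormedSpace ℝ E] {U : Set E}
    (hU : IsOpen U) {A : E → ℝ} (hA : ContDiffOn ℝ ∞ A U) {z : E} (hz : z ∈ U) (v w : E) :
    fderiv ℝ (fun y => fderiv ℝ A y v) z w = fderiv ℝ (fun y => fderiv ℝ A y w) z v := by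
  have hA' : DifferentiableAt ℝ (fderiv ℝ A) z :=
    ((hA.fderiv_of_isOpen (m := 1) hU (by norm_cast)).contDiffAt
      (hU.mem_nhds hz)).differentiableAt one_ne_zero
  have hsymm := (hA.contDiffAt (hU.mem_nhds hz)).isSymmSndFDerivAt (by simp; norm_cast)
  have key : ∀ v w : E, fderiv ℝ (fun y => fderiv ℝ A y v) z w
      = fderiv ℝ (fderiv ℝ A) z w v := fun v w => by
    rw [fderiv_clm_apply hA' (by fun_prop)]; simp
  rw [key, key]; exact hsymm.eq w v

theorem Dt_Dx_comm (hO : IsOpen O) (hf : Sm O f) (h : (t, x) ∈ O) :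
    HNWave.Dt (HNWave.Dx f) t x = HNWave.Dx (HNWave.Dt f) t x := by
  have h1 : HNWave.Dt (HNWave.Dx f) t x
      = HNWave.Dt (fun s y => fderiv ℝ (Function.uncurry f) (s, y) (0, 1)) t x :=
    Dt_congr hO (fun s y hs => hf.Dx_eq hO hs) h
  have h2 : HNWave.Dx (HNWave.Dt f) t x
      = HNWave.Dx (fun s y => fderiv ℝ (Function.uncurry f) (s, y) (1, 0)) t x :=
    Dx_congr hO (fun s y hs => hf.Dt_eq hO hs) h
  rw [h1, h2, Sm.Dt_eq (f := fun s y => fderiv ℝ (Function.uncurry f) (s, y) (0, 1)) hO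
      (contDiffOn_fderiv_apply hO hf (0, 1)) h,
    Sm.Dx_eq (f := fun s y => fderiv ℝ (Function.uncurry f) (s, y) (1, 0)) hO
      (contDiffOn_fderiv_apply hO hf (1, 0)) h]
  exact fderiv_fderiv_apply_comm hO hf h (0, 1) (1, 0)

theorem pd_zero_zero (u : ℝ → ℝ → ℝ) : pd 0 0 u = u := by
  funext t x; simp [pd]

theorem pd_succ_left (i j : ℕ) (u : ℝ → ℝ → ℝ) : pd (i + 1) j u = Dt (pd i j u) := by
  funext t x; simp only [pd, HNWave.Dt, iteratedDeriv_succ]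

theorem pd_zero_succ (j : ℕ) (u : ℝ → ℝ → ℝ) : pd 0 (j + 1) u = Dx (pd 0 j u) := by
  funext t x; simp only [pd, HNWave.Dx, iteratedDeriv_succ, iteratedDeriv_zero]

theorem Sm.pd (hO : IsOpen O) (hf : Sm O f) (i j : ℕ) : Sm O (pd i j f) := by
  induction i with
  | zero =>
    induction j with
    | zero => rwa [pd_zero_zero]
    | succ j ih => rw [pd_zero_succ]; exact ih.Dx hO
  | succ i ih => rw [pd_succ_left]; exact ih.Dt hO

/-- `pd` takes the x-derivatives first, so a further x-derivative has to be commuted past all i time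
derivatives. This is where symmetry of second derivatives enters. -/
theorem Dx_pd (hO : IsOpen O) (hf : Sm O f) (i j : ℕ) :
    ∀ t x, (t, x) ∈ O → HNWave.Dx (HNWave.pd i j f) t x = HNWave.pd i (j + 1) f t x := by
  induction i with
  | zero => intro t x _; rw [pd_zero_succ]
  | succ i ih =>
    intro t x h
    rw [pd_succ_left, pd_succ_left, ← Dt_Dx_comm hO (hf.pd hO i j) h]
    exact Dt_congr hO ih h

theorem Sm.hasDerivAt_pd_t (hO : IsOpen O) (hf : Sm O f) (h : (t, x) ∈ O) (i j : ℕ) :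
    HasDerivAt (fun s => HNWave.pd i j f s x) (HNWave.pd (i + 1) j f t x) t := by
  rw [pd_succ_left]; exact (hf.pd hO i j).hasDerivAt_t hO h

theorem Sm.hasDerivAt_pd_x (hO : IsOpen O) (hf : Sm O f) (h : (t, x) ∈ O) (i j : ℕ) :
    HasDerivAt (fun y => HNWave.pd i j f t y) (HNWave.pd i (j + 1) f t x) x := by
  rw [← Dx_pd hO hf i j t x h]; exact (hf.pd hO i j).hasDerivAt_x hO h

theorem pd_congr (hO : IsOpen O) (hfg : ∀ s y, (s, y) ∈ O → f s y = g s y) (i j : ℕ) :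
    ∀ t x, (t, x) ∈ O → pd i j f t x = pd i j g t x := by
  induction i with
  | zero =>
    induction j with
    | zero => simpa only [pd_zero_zero] using hfg
    | succ j ih => intro t x h; rw [pd_zero_succ, pd_zero_succ]; exact Dx_congr hO ih h
  | succ i ih => intro t x h; rw [pd_succ_left, pd_succ_left]; exact Dt_congr hO ih h

theorem Sm.add (hf : Sm O f) (hg : Sm O g) : Sm O (fun s y => f s y + g s y) :=
  ContDiffOn.add hf hg

theorem Sm.mul (hf : Sm O f) (hg : Sm O g) : Sm O (fun s y => f s y * g s y) :=
  ContDiffOn.mul hf hg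

theorem Sm.sub (hf : Sm O f) (hg : Sm O g) : Sm O (fun s y => f s y - g s y) :=
  ContDiffOn.sub hf hg

theorem Sm.mono {O' : Set (ℝ × ℝ)} (hf : Sm O f) (h : O' ⊆ O) : Sm O' f :=
  ContDiffOn.mono hf h

theorem Sm.continuousOn (hf : Sm O f) : ContinuousOn (Function.uncurry f) O :=
  ContDiffOn.continuousOn hf

theorem pd_add_const_mul (hO : IsOpen O) (hf : Sm O f) (hg : Sm O g) (e : ℝ) (i j : ℕ) :
    ∀ t x, (t, x) ∈ O → HNWave.pd i j (fun s y => f s y + e * g s y) t x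
      = HNWave.pd i j f t x + e * HNWave.pd i j g t x := by
  induction i with
  | zero =>
    induction j with
    | zero => intro t x _; simp only [pd_zero_zero]
    | succ j ih =>
      intro t x h
      rw [pd_zero_succ, Dx_congr hO ih h]
      exact ((hf.hasDerivAt_pd_x hO h 0 j).add
        ((hg.hasDerivAt_pd_x hO h 0 j).const_mul e)).deriv
  | succ i ih =>
    intro t x h
    rw [pd_succ_left, Dt_congr hO ih h]
    exact ((hf.hasDerivAt_pd_t hO h i j).add ((hg.hasDerivAt_pd_t hO h i j).const_mul e)).deriv

theorem Dt_mul (hO : IsOpen O) (hf : Sm O f) (hg : Sm O g) (h : (t, x) ∈ O) :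
    HNWave.Dt (fun s y => f s y * g s y) t x
      = HNWave.Dt f t x * g t x + f t x * HNWave.Dt g t x :=
  ((hf.hasDerivAt_t hO h).mul (hg.hasDerivAt_t hO h)).deriv

theorem Dx_mul (hO : IsOpen O) (hf : Sm O f) (hg : Sm O g) (h : (t, x) ∈ O) :
    HNWave.Dx (fun s y => f s y * g s y) t x
      = HNWave.Dx f t x * g t x + f t x * HNWave.Dx g t x :=
  ((hf.hasDerivAt_x hO h).mul (hg.hasDerivAt_x hO h)).deriv

theorem Dx_sub (hO : IsOpen O) (hf : Sm O f) (hg : Sm O g) (h : (t, x) ∈ O) :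
    HNWave.Dx (fun s y => f s y - g s y) t x = HNWave.Dx f t x - HNWave.Dx g t x :=
  ((hf.hasDerivAt_x hO h).sub (hg.hasDerivAt_x hO h)).deriv

end Calculus

/-! ### The four conservation laws and the Hamiltonian form -/

section Densities

variable {k c R : ℝ} {O : Set (ℝ × ℝ)} {u : ℝ → ℝ → ℝ} {t x : ℝ}

/-- Once every real power is a multiple of p ^ (k - 3), the flux identities are polynomial in the
remaining quantities and `ring` can close them. -/
theorem rpow_eq_rpow_sub_three_mul (k : ℝ) {p : ℝ} (hp : 0 < p) :
    p ^ (k - 2) = p ^ (k - 3) * p ∧ p ^ (k - 1) = p ^ (k - 3) * p ^ 2 ∧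
      p ^ k = p ^ (k - 3) * p ^ 3 ∧ p ^ (k + 1) = p ^ (k - 3) * p ^ 4 := by
  refine ⟨?_, ?_, ?_, ?_⟩
  · rw [← Real.rpow_add_one hp.ne']; ring_nf
  all_goals rw [← Real.rpow_add_natCast hp.ne']; push_cast; ring_nf

theorem hasDerivAt_density (hk : 1 < k) {u p r q : ℝ → ℝ} {u' p' r' q' t : ℝ} (hp : 0 < p t)
    (hu : HasDerivAt u u' t) (hp' : HasDerivAt p p' t) (hr : HasDerivAt r r' t)
    (hq : HasDerivAt q q' t) (i : Fin 4) :
    HasDerivAt (fun s => density k c R i s (u s) (p s) (r s) (q s))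
      (![q', t * q' + q t - u', -(q' * p t + q t * p'),
        q t * q' - c ^ 2 * (1 / 6 * R ^ 2 * ((k - 1) * p t ^ (k - 2) * p' * r t ^ 2
          + 2 * p t ^ (k - 1) * r t * r') - 1 / k * p t ^ k * p')] i) t := by
  have hk0 : k ≠ 0 := by linarith
  have hk1 : k + 1 ≠ 0 := by linarith
  have hP (n : ℝ) := hp'.rpow_const (p := n) (Or.inl hp.ne')
  fin_cases i
  · exact hq
  · refine (((hasDerivAt_id t).mul hq).sub hu).congr_deriv ?_
    simp [-mul_eq_mul_left_iff, -mul_eq_mul_right_iff, -neg_inj, -mul_inv_rev]; ring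
  · exact (hq.mul hp').neg
  · refine (((hq.pow 2).const_mul (1 / 2)).sub ((((((hP (k - 1)).const_mul (1 / 6 * R ^ 2)).mul
      (hr.pow 2))).sub ((hP (k + 1)).const_mul (1 / (k * (k + 1))))).const_mul
        (c ^ 2))).congr_deriv ?_
    simp only [show k - 1 - 1 = k - 2 by ring, show k + 1 - 1 = k by ring]
    simp [-mul_eq_mul_left_iff, -mul_eq_mul_right_iff, -neg_inj, -mul_inv_rev]
    field_simp

/-- The hypotheses `hpr`, `hrs`, `hqm` say that the arguments are successive x-derivatives of one
function; this is what makes the terms assemble into F. The part of the energy flux derivative left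
over beside -qF cancels against the time derivative of the potential energy. -/
theorem hasDerivAt_flux (hk : 1 < k) (t : ℝ) {p r s q m : ℝ → ℝ} {p' r' s' q' m' x : ℝ}
    (hp : 0 < p x) (hp' : HasDerivAt p p' x) (hr : HasDerivAt r r' x) (hs : HasDerivAt s s' x)
    (hq : HasDerivAt q q' x) (hm : HasDerivAt m m' x)
    (hpr : p' = r x) (hrs : r' = s x) (hqm : q' = m x) (i : Fin 4) :
    HasDerivAt (fun y => flux k c R i t (p y) (r y) (s y) (q y) (m y))
      (![-waveF k c R (p x) (r x) (s x) s',
        -t * waveF k c R (p x) (r x) (s x) s',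
        q x * m x + p x * waveF k c R (p x) (r x) (s x) s',
        -q x * waveF k c R (p x) (r x) (s x) s'
          - c ^ 2 * (1 / k * p x ^ k * m x
            + (k - 1) / 6 * R ^ 2 * p x ^ (k - 2) * r x ^ 2 * (-m x)
            - 1 / 3 * R ^ 2 * p x ^ (k - 1) * m' * r x)] i) x := by
  have hk0 : k ≠ 0 := by linarith
  have hk1 : k + 1 ≠ 0 := by linarith
  subst hpr hrs hqm
  have hP (n : ℝ) := hp'.rpow_const (p := n) (Or.inl hp.ne')
  have h0 : HasDerivAt (fun y => 1 / 3 * R ^ 2 * p y ^ (k - 1) * s y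
      + (k - 1) / 6 * R ^ 2 * p y ^ (k - 2) * r y ^ 2 + 1 / k * p y ^ k) _ x :=
    ((((hP (k - 1)).const_mul (1 / 3 * R ^ 2)).mul hs).add
      (((hP (k - 2)).const_mul ((k - 1) / 6 * R ^ 2)).mul (hr.pow 2))).add
        ((hP k).const_mul (1 / k))
  obtain ⟨e2, e1, e0, -⟩ := rpow_eq_rpow_sub_three_mul k hp
  fin_cases i
  · refine (h0.const_mul (-c ^ 2)).congr_deriv ?_
    simp only [waveF, show k - 1 - 1 = k - 2 by ring, show k - 2 - 1 = k - 3 by ring, Pi.pow_apply,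
      e2, e1, e0]
    simp [-mul_eq_mul_left_iff, -mul_eq_mul_right_iff, -neg_inj, -mul_inv_rev]
    field_simp
    ring
  · refine (h0.const_mul (-c ^ 2 * t)).congr_deriv ?_
    simp only [waveF, show k - 1 - 1 = k - 2 by ring, show k - 2 - 1 = k - 3 by ring, Pi.pow_apply,
      e2, e1, e0]
    simp [-mul_eq_mul_left_iff, -mul_eq_mul_right_iff, -neg_inj, -mul_inv_rev]
    field_simp
    ring
  · refine (((hq.pow 2).const_mul (1 / 2)).add (((((((hP k).const_mul (1 / 3 * R ^ 2)).mul hs).add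
      (((hP (k - 1)).const_mul ((k - 2) / 6 * R ^ 2)).mul (hr.pow 2))).add
        ((hP (k + 1)).const_mul (1 / (k + 1))))).const_mul (c ^ 2))).congr_deriv ?_
    simp only [waveF, show k - 1 - 1 = k - 2 by ring, show k + 1 - 1 = k by ring, e2, e1, e0]
    simp [-mul_eq_mul_left_iff, -mul_eq_mul_right_iff, -neg_inj, -mul_inv_rev]
    field_simp
    ring
  · refine ((((((hP (k - 1)).const_mul (1 / 3 * R ^ 2)).mul ((hq.mul hs).sub (hm.mul hr))).add
      ((((hP (k - 2)).const_mul ((k - 1) / 6 * R ^ 2)).mul hq).mul (hr.pow 2))).add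
        (((hP k).const_mul (1 / k)).mul hq)).const_mul (-c ^ 2)).congr_deriv ?_
    simp only [waveF, show k - 1 - 1 = k - 2 by ring, show k - 2 - 1 = k - 3 by ring, Pi.mul_apply,
      Pi.pow_apply, Pi.sub_apply, e2, e1, e0]
    simp [-mul_eq_mul_left_iff, -mul_eq_mul_right_iff, -neg_inj, -mul_inv_rev]
    field_simp
    ring

/-- The characteristic form of the four conservation laws. -/
theorem Dt_densityOn_add_Dx_fluxOn (hk : 1 < k) (hO : IsOpen O) (hu : Sm O u) (h : (t, x) ∈ O)
    (hp : 0 < pd 0 1 u t x) (i : Fin 4) :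
    Dt (densityOn k c R i u) t x + Dx (fluxOn k c R i u) t x
      = waveOp k c R u t x * mult i (firstJet u t x) := by
  have h0 : HasDerivAt (fun s => u s x) (pd 1 0 u t x) t := by
    simpa only [pd_zero_zero] using hu.hasDerivAt_pd_t hO h 0 0
  have e1 := (hasDerivAt_density (c := c) (R := R) (p := fun s => pd 0 1 u s x)
    (r := fun s => pd 0 2 u s x) (q := fun s => pd 1 0 u s x) hk hp h0 (hu.hasDerivAt_pd_t hO h 0 1)
    (hu.hasDerivAt_pd_t hO h 0 2) (hu.hasDerivAt_pd_t hO h 1 0) i).deriv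
  have e2 := (hasDerivAt_flux (c := c) (R := R) hk t hp (hu.hasDerivAt_pd_x hO h 0 1)
    (hu.hasDerivAt_pd_x hO h 0 2) (hu.hasDerivAt_pd_x hO h 0 3) (hu.hasDerivAt_pd_x hO h 1 0)
    (hu.hasDerivAt_pd_x hO h 1 1) rfl rfl rfl i).deriv
  have e1' : Dt (densityOn k c R i u) t x = _ := e1
  have e2' : Dx (fluxOn k c R i u) t x = _ := e2
  rw [e1', e2']
  fin_cases i <;> simp [waveOp, mult, firstJet] <;> ring

theorem hasDerivAt_density_mult (i : Fin 4) (t x u p r q : ℝ) :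
    HasDerivAt (fun q' => density k c R i t u p r q') (mult i (t, x, u, p, q)) q := by
  have hq := hasDerivAt_id q
  fin_cases i
  · exact hq
  · refine ((hq.const_mul t).sub_const u).congr_deriv ?_
    simp [mult]
  · refine (hq.mul_const p).neg.congr_deriv ?_
    simp [mult]
  · refine (((hq.pow 2).const_mul (1 / 2)).sub_const _).congr_deriv ?_
    simp [mult]

/-- `T₄` is the Hamiltonian density. -/
theorem densityOn_three_eq_hamiltonian :
    densityOn k c R 3 u t x = hamiltonian k c R (-pd 1 0 u t x) (pd 0 1 u t x)
      (Dx (pd 0 1 u) t x) := by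
  rw [← pd_zero_succ]
  simp [densityOn, density, hamiltonian, lagrangian₀, -mul_eq_mul_left_iff, -mul_inv_rev]
  ring

theorem hasDerivAt_hamiltonian_vx (w v vx : ℝ) :
    HasDerivAt (fun b => hamiltonian k c R w v b)
      (-(c ^ 2 * (1 / 3 * R ^ 2 * v ^ (k - 1) * vx))) vx := by
  refine (((((hasDerivAt_pow 2 vx).const_mul (1 / 6 * R ^ 2 * v ^ (k - 1))).const_add
    (-1 / (k * (k + 1)) * v ^ (k + 1))).const_mul (c ^ 2)).const_sub
      (1 / 2 * w ^ 2)).congr_deriv ?_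
  simp [-mul_eq_mul_left_iff, -mul_eq_mul_right_iff, -neg_inj, -mul_inv_rev]; ring

theorem hasDerivAt_hamiltonian_v (hk : 1 < k) (w : ℝ) {v : ℝ} (vx : ℝ) (hv : 0 < v) :
    HasDerivAt (fun a => hamiltonian k c R w a vx)
      (-(c ^ 2 * (-1 / k * v ^ k + (k - 1) / 6 * R ^ 2 * v ^ (k - 2) * vx ^ 2))) v := by
  have hk0 : k ≠ 0 := by linarith
  have hk1 : k + 1 ≠ 0 := by linarith
  have hP (n : ℝ) := (hasDerivAt_id v).rpow_const (p := n) (Or.inl hv.ne')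
  refine (((((hP (k + 1)).const_mul (-1 / (k * (k + 1)))).add
    (((hP (k - 1)).const_mul (1 / 6 * R ^ 2)).mul_const (vx ^ 2))).const_mul (c ^ 2)).const_sub
      (1 / 2 * w ^ 2)).congr_deriv ?_
  simp only [show k - 1 - 1 = k - 2 by ring, show k + 1 - 1 = k by ring]
  simp [-mul_eq_mul_left_iff, -mul_eq_mul_right_iff, -neg_inj, -mul_inv_rev]
  field_simp

theorem hasDerivAt_hamiltonian_w (w v vx : ℝ) :
    HasDerivAt (fun a => hamiltonian k c R a v vx) w w := by
  refine (((hasDerivAt_pow 2 w).const_mul (1 / 2)).sub_const _).congr_deriv ?_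
  simp [-mul_eq_mul_left_iff, -mul_eq_mul_right_iff, -neg_inj, -mul_inv_rev]

/-- The wave equation is Hamilton's system in `v = u_x`, `w = -u_t`. -/
theorem waveOp_eq_zero_iff_hamiltonEqs (hk : 1 < k) (hO : IsOpen O) (hu : Sm O u)
    (hp : ∀ t x, (t, x) ∈ O → 0 < pd 0 1 u t x) (h : (t, x) ∈ O) :
    waveOp k c R u t x = 0 ↔
      HamiltonEqs k c R (fun s y => -pd 1 0 u s y) (pd 0 1 u) t x := by
  have hW : deltaW k c R (fun s y => -pd 1 0 u s y) (pd 0 1 u) = fun s y => -pd 1 0 u s y := by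
    funext s y; exact (hasDerivAt_hamiltonian_w _ _ _).deriv
  -- δH/δv is minus the momentum flux X₁, so the second Hamilton equation is the conservation law of
  -- T₁ with its sign reversed.
  have hV : ∀ s y, (s, y) ∈ O →
      deltaV k c R (fun s y => -pd 1 0 u s y) (pd 0 1 u) s y
        = -fluxOn k c R 0 u s y := by
    intro s y hs
    have e : (fun s y => deriv (fun b => hamiltonian k c R (-pd 1 0 u s y) (pd 0 1 u s y) b)
        (Dx (pd 0 1 u) s y))
        = fun s y => -(c ^ 2 * (1 / 3 * R ^ 2 * pd 0 1 u s y ^ (k - 1) * pd 0 2 u s y)) := by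
      funext s y; rw [← pd_zero_succ]; exact (hasDerivAt_hamiltonian_vx _ _ _).deriv
    have e' := ((((((hu.hasDerivAt_pd_x hO hs 0 1).rpow_const (p := k - 1)
      (Or.inl (hp s y hs).ne')).const_mul (1 / 3 * R ^ 2)).mul
        (hu.hasDerivAt_pd_x hO hs 0 2)).const_mul (c ^ 2)).neg).deriv
    have e'' : Dx (fun s y =>
        -(c ^ 2 * (1 / 3 * R ^ 2 * pd 0 1 u s y ^ (k - 1) * pd 0 2 u s y))) s y = _ := e'
    simp only [deltaV]
    rw [(hasDerivAt_hamiltonian_v hk _ _ (hp s y hs)).deriv, e, e'', ← pd_zero_succ]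
    simp only [show k - 1 - 1 = k - 2 by ring]
    simp [fluxOn, flux]
    ring
  have hX : Dx (fluxOn k c R 0 u) t x = -waveF k c R (pd 0 1 u t x) (pd 0 2 u t x)
      (pd 0 3 u t x) (pd 0 4 u t x) :=
    (hasDerivAt_flux (c := c) (R := R) hk t (hp t x h) (hu.hasDerivAt_pd_x hO h 0 1)
      (hu.hasDerivAt_pd_x hO h 0 2) (hu.hasDerivAt_pd_x hO h 0 3) (hu.hasDerivAt_pd_x hO h 1 0)
      (hu.hasDerivAt_pd_x hO h 1 1) rfl rfl rfl 0).deriv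
  have hVx : Dx (deltaV k c R (fun s y => -pd 1 0 u s y) (pd 0 1 u)) t x
      = waveF k c R (pd 0 1 u t x) (pd 0 2 u t x) (pd 0 3 u t x) (pd 0 4 u t x) := by
    rw [Dx_congr hO hV h]
    have : Dx (fun s y => -fluxOn k c R 0 u s y) t x
      = -Dx (fluxOn k c R 0 u) t x := by
      simp [Dx]
    rw [this, hX, neg_neg]
  -- The first Hamilton equation is only u_xt = u_tx and holds for every smooth u.
  have h1 : Dt (pd 0 1 u) t x = -Dx (fun s y => -pd 1 0 u s y) t x := by
    have : Dx (fun s y => -pd 1 0 u s y) t x = _ := (hu.hasDerivAt_pd_x hO h 1 0).neg.deriv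
    rw [this, ← pd_succ_left, neg_neg]
  have h2 : Dt (fun s y => -pd 1 0 u s y) t x = -pd 2 0 u t x :=
    (hu.hasDerivAt_pd_t hO h 1 0).neg.deriv
  simp only [HamiltonEqs, hW, hVx, h2, waveOp]
  constructor
  · intro e; exact ⟨h1, by linarith⟩
  · intro e; linarith [e.2]

end Densities

/-! ### Differentiation under the integral and the integrated conservation laws -/

section Integral

/-- Differentiation under the integral sign over a compact set. -/
theorem hasDerivAt_setIntegral_of_contDiffOn {E : Type*} [NormedAddCommGroup E] [NormedSpace ℝ E]
    [MeasurableSpace E] [BorelSpace E] (μ : Measure E) [IsFiniteMeasureOnCompacts μ] {K : Set E}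
    (hK : IsCompact K) {W : Set (ℝ × E)} (hW : IsOpen W) {Φ : ℝ × E → ℝ}
    (hΦ : ContDiffOn ℝ 1 Φ W) {t₀ : ℝ} (hKW : {t₀} ×ˢ K ⊆ W) :
    HasDerivAt (fun s => ∫ z in K, Φ (s, z) ∂μ)
      (∫ z in K, fderiv ℝ Φ (t₀, z) (1, 0) ∂μ) t₀ := by
  -- The tube lemma turns the inclusion of the single slice into one for a whole time interval, on
  -- which compactness bounds the derivative uniformly.
  obtain ⟨a, b, ha, hb, hta, hKb, hab⟩ :=
    generalized_tube_lemma isCompact_singleton hK hW hKW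
  obtain ⟨δ, hδ, hδa⟩ := Metric.nhds_basis_closedBall.mem_iff.1
    (ha.mem_nhds (hta (mem_singleton t₀)))
  have hsub : Metric.closedBall t₀ δ ×ˢ K ⊆ W := (prod_mono hδa hKb).trans hab
  have hcd : ContinuousOn (fun w => fderiv ℝ Φ w (1, 0)) W :=
    (hΦ.continuousOn_fderiv_of_isOpen hW le_rfl).clm_apply continuousOn_const
  obtain ⟨C, hC⟩ := (((isCompact_closedBall t₀ δ).prod hK).exists_bound_of_continuousOn
    (hcd.mono hsub))
  have hsec : ∀ s ∈ Metric.closedBall t₀ δ, ∀ {f : ℝ × E → ℝ}, ContinuousOn f W →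
      ContinuousOn (fun z => f (s, z)) K := fun s hs f hf =>
    hf.comp (by fun_prop) fun z hz => hsub ⟨hs, hz⟩
  have ht₀ : t₀ ∈ Metric.closedBall t₀ δ := Metric.mem_closedBall_self hδ.le
  refine (hasDerivAt_integral_of_dominated_loc_of_deriv_le (μ := μ.restrict K)
    (F := fun s z => Φ (s, z)) (F' := fun s z => fderiv ℝ Φ (s, z) (1, 0))
    (bound := fun _ => C) (Metric.closedBall_mem_nhds t₀ hδ) ?_ ?_ ?_ ?_ ?_ ?_).2
  · filter_upwards [Metric.closedBall_mem_nhds t₀ hδ] with s hs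
    exact (hsec s hs hΦ.continuousOn).aestronglyMeasurable_of_isCompact hK hK.measurableSet
  · exact (hsec t₀ ht₀ hΦ.continuousOn).integrableOn_compact hK
  · exact (hsec t₀ ht₀ hcd).aestronglyMeasurable_of_isCompact hK hK.measurableSet
  · exact (ae_restrict_mem hK.measurableSet).mono fun z hz s hs => hC (s, z) ⟨hs, hz⟩
  · exact integrableOn_const hK.measure_lt_top.ne
  · refine (ae_restrict_mem hK.measurableSet).mono fun z hz s hs => ?_
    have hd : DifferentiableAt ℝ Φ (s, z) :=
      (hΦ.contDiffAt (hW.mem_nhds (hsub ⟨hs, hz⟩))).differentiableAt one_ne_zero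
    exact hd.hasFDerivAt.comp_hasDerivAt s (f := fun s : ℝ => (s, z))
      ((hasDerivAt_id s).prodMk (hasDerivAt_const s z))

variable {k c R : ℝ} {O : Set (ℝ × ℝ)} {u : ℝ → ℝ → ℝ} {t x : ℝ}

theorem contDiffOn_rpow_const {E : Type*} [NormedAddCommGroup E] [NormedSpace ℝ E] {U : Set E}
    {f : E → ℝ} (hf : ContDiffOn ℝ ∞ f U) (hpos : ∀ z ∈ U, 0 < f z) (n : ℝ) :
    ContDiffOn ℝ ∞ (fun z => f z ^ n) U :=
  hf.rpow_const_of_ne fun z hz => (hpos z hz).ne'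

theorem contDiffOn_density {E : Type*} [NormedAddCommGroup E] [NormedSpace ℝ E] {U : Set E}
    {t u p r q : E → ℝ} (ht : ContDiffOn ℝ ∞ t U) (hu : ContDiffOn ℝ ∞ u U)
    (hp : ContDiffOn ℝ ∞ p U) (hr : ContDiffOn ℝ ∞ r U) (hq : ContDiffOn ℝ ∞ q U)
    (hpos : ∀ z ∈ U, 0 < p z) (i : Fin 4) :
    ContDiffOn ℝ ∞ (fun z => density k c R i (t z) (u z) (p z) (r z) (q z)) U := by
  have hP := contDiffOn_rpow_const hp hpos
  have h1 := hP (k - 1)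
  have h2 := hP (k + 1)
  fin_cases i <;> simp only [density] <;> dsimp <;> fun_prop

theorem contDiffOn_flux {E : Type*} [NormedAddCommGroup E] [NormedSpace ℝ E] {U : Set E}
    {t p r s q m : E → ℝ} (ht : ContDiffOn ℝ ∞ t U) (hp : ContDiffOn ℝ ∞ p U)
    (hr : ContDiffOn ℝ ∞ r U) (hs : ContDiffOn ℝ ∞ s U) (hq : ContDiffOn ℝ ∞ q U)
    (hm : ContDiffOn ℝ ∞ m U) (hpos : ∀ z ∈ U, 0 < p z) (i : Fin 4) :
    ContDiffOn ℝ ∞ (fun z => flux k c R i (t z) (p z) (r z) (s z) (q z) (m z)) U := by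
  have hP := contDiffOn_rpow_const hp hpos
  have h1 := hP (k - 1)
  have h2 := hP (k - 2)
  have h3 := hP k
  have h4 := hP (k + 1)
  fin_cases i <;> simp only [flux] <;> dsimp <;> fun_prop

theorem Sm.densityOn (hO : IsOpen O) (hu : Sm O u)
    (hp : ∀ t x, (t, x) ∈ O → 0 < HNWave.pd 0 1 u t x) (i : Fin 4) :
    Sm O (HNWave.densityOn k c R i u) :=
  contDiffOn_density contDiffOn_fst hu (Sm.pd hO hu 0 1) (Sm.pd hO hu 0 2)
    (Sm.pd hO hu 1 0) (fun z hz => hp z.1 z.2 hz) i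

theorem Sm.fluxOn (hO : IsOpen O) (hu : Sm O u)
    (hp : ∀ t x, (t, x) ∈ O → 0 < HNWave.pd 0 1 u t x) (i : Fin 4) :
    Sm O (HNWave.fluxOn k c R i u) :=
  contDiffOn_flux contDiffOn_fst (hu.pd hO 0 1) (hu.pd hO 0 2) (hu.pd hO 0 3) (hu.pd hO 1 0)
    (hu.pd hO 1 1) (fun z hz => hp z.1 z.2 hz) i

/-- The global form of a local continuity equation. -/
theorem hasDerivAt_integral_of_continuity {T X : ℝ → ℝ → ℝ} (hO : IsOpen O) (hT : Sm O T)
    (hX : Sm O X) (hTX : ∀ t x, (t, x) ∈ O → Dt T t x + Dx X t x = 0) {t a b : ℝ} (hab : a ≤ b)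
    (h : ∀ x ∈ Icc a b, (t, x) ∈ O) :
    HasDerivAt (fun s => ∫ x in a..b, T s x) (-(X t b - X t a)) t := by
  have key := hasDerivAt_setIntegral_of_contDiffOn volume (isCompact_Icc (a := a) (b := b)) hO
    (hT.of_le (by norm_cast)) (t₀ := t) (by rintro ⟨s, y⟩ ⟨rfl, hy⟩; exact h y hy)
  simp only [intervalIntegral.integral_of_le hab, ← integral_Icc_eq_integral_Ioc]
  refine key.congr_deriv ?_
  have e : ∀ y ∈ Icc a b, fderiv ℝ (Function.uncurry T) (t, y) (1, 0) = -Dx X t y := by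
    intro y hy
    rw [← hT.Dt_eq hO (h y hy)]; linarith [hTX t y (h y hy)]
  rw [setIntegral_congr_fun measurableSet_Icc e, integral_neg, integral_Icc_eq_integral_Ioc,
    ← intervalIntegral.integral_of_le hab]
  congr 1
  refine intervalIntegral.integral_eq_sub_of_hasDerivAt (fun y hy => ?_) ?_
  · rw [uIcc_of_le hab] at hy; exact hX.hasDerivAt_x hO (h y hy)
  · refine ContinuousOn.intervalIntegrable ?_
    rw [uIcc_of_le hab]
    exact (hX.Dx hO).continuousOn.comp (f := fun y : ℝ => (t, y)) (by fun_prop) h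

end Integral

/-! ### The four functions are independent multipliers -/

section Sufficiency

variable {k c R : ℝ} {U : Set FirstJet}

/-- Linear combinations of `1, t, -u_x, u_t` are multipliers. -/
theorem isMultiplier_of_eq_sum (hk : 1 < k) (hU : U ⊆ posStrain) {Q : FirstJet → ℝ}
    {a : Fin 4 → ℝ} (hQ : ∀ z ∈ U, Q z = ∑ i, a i * mult i z) : IsMultiplier k c R U Q := by
  have hproj : ∀ i j : Fin 4, ContDiffOn ℝ ∞ (fun z : Jet 2 => z.2.2 i j) (jetDomain 2 U) := by
    intro i j; exact ContDiff.contDiffOn (by fun_prop)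
  have hfst : ContDiffOn ℝ ∞ (fun z : Jet 2 => z.1) (jetDomain 2 U) := contDiffOn_fst
  -- `Jet 2` carries derivatives of order up to 3 in each variable, just enough for the u_xxx in the
  -- fluxes.
  refine ⟨?_, 2,
    fun z => ∑ i, a i * density k c R i z.1 (z.2.2 0 0) (z.2.2 0 1) (z.2.2 0 2) (z.2.2 1 0),
    fun z => ∑ i, a i * flux k c R i z.1 (z.2.2 0 1) (z.2.2 0 2) (z.2.2 0 3) (z.2.2 1 0)
      (z.2.2 1 1), ?_, ?_, ?_⟩
  · refine ContDiffOn.congr (ContDiff.contDiffOn ?_) hQ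
    refine ContDiff.sum fun i _ => contDiff_const.mul ?_
    fin_cases i
    · exact contDiff_const
    · exact contDiff_fst
    · exact ContDiff.neg (f := fun z : FirstJet => z.2.2.2.1) (by fun_prop)
    · exact (by fun_prop : ContDiff ℝ ∞ fun z : FirstJet => z.2.2.2.2)
  · exact ContDiffOn.sum fun i _ => contDiffOn_const.mul (contDiffOn_density hfst (hproj 0 0)
      (hproj 0 1) (hproj 0 2) (hproj 1 0) (fun z hz => hU hz) i)
  · exact ContDiffOn.sum fun i _ => contDiffOn_const.mul (contDiffOn_flux hfst
      (hproj 0 1) (hproj 0 2) (hproj 0 3) (hproj 1 0) (hproj 1 1) (fun z hz => hU hz) i)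
  · rintro O u ⟨hO, hu, hj⟩ t x h
    have hp : ∀ t x, (t, x) ∈ O → 0 < pd 0 1 u t x := fun t x h => hU (hj t x h)
    have hu' : Sm O u := hu
    have eT : (fun s y => ∑ i, a i * density k c R i (jet 2 u s y).1 ((jet 2 u s y).2.2 0 0)
        ((jet 2 u s y).2.2 0 1) ((jet 2 u s y).2.2 0 2) ((jet 2 u s y).2.2 1 0))
        = fun s y => ∑ i, a i * densityOn k c R i u s y := by
      funext s y
      have e0 : (jet 2 u s y).2.2 0 0 = u s y := congrFun (congrFun (pd_zero_zero u) s) y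
      rw [e0]
      rfl
    have eX : (fun s y => ∑ i, a i * flux k c R i (jet 2 u s y).1 ((jet 2 u s y).2.2 0 1)
        ((jet 2 u s y).2.2 0 2) ((jet 2 u s y).2.2 0 3) ((jet 2 u s y).2.2 1 0)
        ((jet 2 u s y).2.2 1 1)) = fun s y => ∑ i, a i * fluxOn k c R i u s y := rfl
    rw [eT, eX]
    have dT : Dt (fun s y => ∑ i, a i * densityOn k c R i u s y) t x = _ :=
      (HasDerivAt.fun_sum fun i (_ : i ∈ Finset.univ) =>
        (((hu'.densityOn hO hp i).hasDerivAt_t hO h).const_mul (a i))).deriv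
    have dX : Dx (fun s y => ∑ i, a i * fluxOn k c R i u s y) t x = _ :=
      (HasDerivAt.fun_sum fun i (_ : i ∈ Finset.univ) =>
        (((hu'.fluxOn hO hp i).hasDerivAt_x hO h).const_mul (a i))).deriv
    rw [dT, dX, hQ _ (hj t x h), ← Finset.sum_add_distrib, Finset.mul_sum]
    refine Finset.sum_congr rfl fun i _ => ?_
    rw [← mul_add, Dt_densityOn_add_Dx_fluxOn hk hO hu' h (hp t x h)]
    ring

/-- Since U is open, a point of it can be moved slightly along the t, u_x or u_t axis. Each move
changes exactly one of the nonconstant multipliers and so isolates its coefficient. -/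
theorem mult_linearIndependent (hU : IsOpen U) (hne : U.Nonempty) {a : Fin 4 → ℝ}
    (ha : ∀ z ∈ U, ∑ i, a i * mult i z = 0) : a = 0 := by
  obtain ⟨⟨t, x, u, p, q⟩, hz⟩ := hne
  have key : ∀ v : FirstJet, ∃ e : ℝ, e ≠ 0 ∧ (t, x, u, p, q) + e • v ∈ U := by
    intro v
    have hc : ContinuousAt (fun e : ℝ => ((t, x, u, p, q) : FirstJet) + e • v) 0 := by fun_prop
    have h1 := hc.eventually (hU.mem_nhds (by simpa using hz))
    have h2 : ∀ᶠ e : ℝ in 𝓝[≠] 0, ((t, x, u, p, q) : FirstJet) + e • v ∈ U ∧ e ≠ 0 :=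
      (h1.filter_mono nhdsWithin_le_nhds).and self_mem_nhdsWithin
    obtain ⟨e, he, he'⟩ := h2.exists
    exact ⟨e, he', he⟩
  have h0 := ha _ hz
  obtain ⟨e1, he1, h1⟩ := key (1, 0, 0, 0, 0)
  obtain ⟨e2, he2, h2⟩ := key (0, 0, 0, 1, 0)
  obtain ⟨e3, he3, h3⟩ := key (0, 0, 0, 0, 1)
  replace h1 := ha _ h1
  replace h2 := ha _ h2
  replace h3 := ha _ h3
  simp [Fin.sum_univ_four, mult] at h0 h1 h2 h3
  have a1 : a 1 = 0 := by
    have : a 1 * e1 = 0 := by linarith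
    simpa [he1] using this
  have a2 : a 2 = 0 := by
    have : a 2 * e2 = 0 := by linarith
    simpa [he2] using this
  have a3 : a 3 = 0 := by
    have : a 3 * e3 = 0 := by linarith
    simpa [he3] using this
  have a0 : a 0 = 0 := by simpa [a1, a2, a3] using h0
  funext i; fin_cases i <;> assumption

end Sufficiency

/-! ### Test functions, integration by parts, the fundamental lemma -/

section TestFunctions

theorem contDiff_of_contDiffOn_of_eq_zero {E : Type*} [NormedAddCommGroup E] [NormedSpace ℝ E]
    {O K : Set E} (hO : IsOpen O) (hK : IsClosed K) (hKO : K ⊆ O) {f : E → ℝ}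
    (hf : ContDiffOn ℝ ∞ f O) (h0 : ∀ z ∉ K, f z = 0) : ContDiff ℝ ∞ f := by
  refine contDiff_iff_contDiffAt.2 fun z => ?_
  by_cases hz : z ∈ K
  · exact hf.contDiffAt (hO.mem_nhds (hKO hz))
  · refine (contDiffAt_const (c := (0 : ℝ))).congr_of_eventuallyEq ?_
    filter_upwards [hK.isOpen_compl.mem_nhds hz] with w hw using h0 w hw

/-- Smooth functions of `(t, x)` with compact support inside `O`. -/
def Test (O : Set (ℝ × ℝ)) (φ : ℝ → ℝ → ℝ) : Prop :=
  ContDiff ℝ ∞ (Function.uncurry φ) ∧ HasCompactSupport (Function.uncurry φ) ∧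
    tsupport (Function.uncurry φ) ⊆ O

variable {O : Set (ℝ × ℝ)} {A φ ψ : ℝ → ℝ → ℝ}

theorem Test.sm (h : Test O φ) : Sm univ φ := h.1.contDiffOn

theorem Test.smOn (h : Test O φ) : Sm O φ := h.1.contDiffOn

theorem Test.eq_zero (_h : Test O φ) {t x : ℝ} (hz : (t, x) ∉ tsupport (Function.uncurry φ)) :
    φ t x = 0 := image_eq_zero_of_notMem_tsupport (f := Function.uncurry φ) hz

/-- O and the complement of K cover the plane by open sets on which the function is smooth, so
smoothness on O is enough to get a global test function. -/
theorem test_of_eq_zero {K : Set (ℝ × ℝ)} (hO : IsOpen O) (hK : IsCompact K) (hKO : K ⊆ O)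
    (hA : Sm O A) (h0 : ∀ t x, (t, x) ∉ K → A t x = 0) : Test O A := by
  have hsupp : tsupport (Function.uncurry A) ⊆ K :=
    closure_minimal (fun z hz => by
      by_contra hzK; exact hz (h0 z.1 z.2 hzK)) hK.isClosed
  exact ⟨contDiff_of_contDiffOn_of_eq_zero hO hK.isClosed hKO hA (fun z hz => h0 z.1 z.2 hz),
    HasCompactSupport.intro hK (fun z hz => h0 z.1 z.2 hz), hsupp.trans hKO⟩

theorem Test.mul (hO : IsOpen O) (hA : Sm O A) (h : Test O φ) :
    Test O (fun s y => A s y * φ s y) :=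
  test_of_eq_zero hO h.2.1 h.2.2 (hA.mul h.smOn) fun t x hz => by rw [h.eq_zero hz, mul_zero]

theorem Test.Dx_eq_zero (h : Test O φ) {t x : ℝ}
    (hz : (t, x) ∉ tsupport (Function.uncurry φ)) : Dx φ t x = 0 := by
  rw [h.sm.Dx_eq isOpen_univ (mem_univ _), fderiv_of_notMem_tsupport ℝ hz]; rfl

theorem Test.Dt_eq_zero (h : Test O φ) {t x : ℝ}
    (hz : (t, x) ∉ tsupport (Function.uncurry φ)) : Dt φ t x = 0 := by
  rw [h.sm.Dt_eq isOpen_univ (mem_univ _), fderiv_of_notMem_tsupport ℝ hz]; rfl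

theorem Test.Dx (hO : IsOpen O) (h : Test O φ) : Test O (Dx φ) :=
  test_of_eq_zero hO h.2.1 h.2.2 (h.smOn.Dx hO) fun _ _ hz => h.Dx_eq_zero hz

theorem Test.Dt (hO : IsOpen O) (h : Test O φ) : Test O (Dt φ) :=
  test_of_eq_zero hO h.2.1 h.2.2 (h.smOn.Dt hO) fun _ _ hz => h.Dt_eq_zero hz

theorem Test.sub (hO : IsOpen O) (hφ : Test O φ) (hψ : Test O ψ) :
    Test O (fun s y => φ s y - ψ s y) :=
  test_of_eq_zero hO (hφ.2.1.isCompact.union hψ.2.1.isCompact) (union_subset hφ.2.2 hψ.2.2)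
    (hφ.smOn.sub hψ.smOn) fun t x hz => by
      rw [mem_union, not_or] at hz
      rw [hφ.eq_zero hz.1, hψ.eq_zero hz.2, sub_zero]

theorem Test.integrable (h : Test O φ) : Integrable (fun z : ℝ × ℝ => φ z.1 z.2) :=
  h.1.continuous.integrable_of_hasCompactSupport h.2.1

/-- Integration by parts against the constant function 1. -/
theorem integral_fderiv_eq_zero {f : ℝ × ℝ → ℝ} (hf : ContDiff ℝ ∞ f)
    (hs : HasCompactSupport f) (v : ℝ × ℝ) : ∫ z, fderiv ℝ f z v = 0 := by
  have hd : Continuous fun z => fderiv ℝ f z v :=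
    (hf.continuous_fderiv (by simp)).clm_apply continuous_const
  have hi : Integrable fun z => fderiv ℝ f z v :=
    hd.integrable_of_hasCompactSupport
      ((hs.fderiv (𝕜 := ℝ)).comp_left (g := fun l : ℝ × ℝ →L[ℝ] ℝ => l v) rfl)
  have := integral_mul_fderiv_eq_neg_fderiv_mul_of_integrable (μ := (volume : Measure (ℝ × ℝ)))
    (f := fun _ => (1 : ℝ)) (g := f) (v := v) (by simp) (by simpa using hi)
    (by simpa using hf.continuous.integrable_of_hasCompactSupport hs)
    (fun _ _ => by fun_prop) (fun z _ => (hf.differentiable (by simp)).differentiableAt)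
  simpa using this

theorem Test.integral_Dx (h : Test O φ) : ∫ z : ℝ × ℝ, HNWave.Dx φ z.1 z.2 = 0 := by
  rw [← integral_fderiv_eq_zero h.1 h.2.1 (0, 1)]
  exact integral_congr_ae (Eventually.of_forall fun z => h.sm.Dx_eq isOpen_univ (mem_univ _))

theorem Test.integral_Dt (h : Test O φ) : ∫ z : ℝ × ℝ, HNWave.Dt φ z.1 z.2 = 0 := by
  rw [← integral_fderiv_eq_zero h.1 h.2.1 (1, 0)]
  exact integral_congr_ae (Eventually.of_forall fun z => h.sm.Dt_eq isOpen_univ (mem_univ _))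

/-- The pairing of a function on `O` with a test function. -/
def pair (A φ : ℝ → ℝ → ℝ) : ℝ := ∫ z : ℝ × ℝ, A z.1 z.2 * φ z.1 z.2

theorem pair_Dx (hO : IsOpen O) (hA : Sm O A) (h : Test O φ) :
    pair A (Dx φ) = -pair (Dx A) φ := by
  have h1 := (Test.mul hO hA h).integral_Dx
  have e : ∀ z : ℝ × ℝ, HNWave.Dx (fun s y => A s y * φ s y) z.1 z.2
      = HNWave.Dx A z.1 z.2 * φ z.1 z.2 + A z.1 z.2 * HNWave.Dx φ z.1 z.2 := by
    intro z
    -- A is smooth only on O, so the product rule is available only there; off the support of φ both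
    -- sides vanish.
    by_cases hz : z ∈ tsupport (Function.uncurry φ)
    · exact Dx_mul hO hA h.smOn (h.2.2 hz)
    · have hz' : (z.1, z.2) ∉ tsupport (Function.uncurry fun s y => A s y * φ s y) :=
        fun h' => hz (tsupport_mul_subset_right (f := Function.uncurry A) h')
      rw [(Test.mul hO hA h).Dx_eq_zero hz', h.eq_zero hz, h.Dx_eq_zero hz]; simp
  simp only [e] at h1
  rw [integral_add (Test.mul hO (hA.Dx hO) h).integrable
    (Test.mul hO hA (h.Dx hO)).integrable] at h1
  unfold pair; linarith

theorem pair_Dt (hO : IsOpen O) (hA : Sm O A) (h : Test O φ) :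
    pair A (Dt φ) = -pair (Dt A) φ := by
  have h1 := (Test.mul hO hA h).integral_Dt
  have e : ∀ z : ℝ × ℝ, HNWave.Dt (fun s y => A s y * φ s y) z.1 z.2
      = HNWave.Dt A z.1 z.2 * φ z.1 z.2 + A z.1 z.2 * HNWave.Dt φ z.1 z.2 := by
    intro z
    by_cases hz : z ∈ tsupport (Function.uncurry φ)
    · exact Dt_mul hO hA h.smOn (h.2.2 hz)
    · have hz' : (z.1, z.2) ∉ tsupport (Function.uncurry fun s y => A s y * φ s y) :=
        fun h' => hz (tsupport_mul_subset_right (f := Function.uncurry A) h')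
      rw [(Test.mul hO hA h).Dt_eq_zero hz', h.eq_zero hz, h.Dt_eq_zero hz]; simp
  simp only [e] at h1
  rw [integral_add (Test.mul hO (hA.Dt hO) h).integrable
    (Test.mul hO hA (h.Dt hO)).integrable] at h1
  unfold pair; linarith

theorem pair_mul_right (A B φ : ℝ → ℝ → ℝ) :
    pair A (fun s y => B s y * φ s y) = pair (fun s y => B s y * A s y) φ := by
  unfold pair; congr 1; funext z; ring

/-- The fundamental lemma of the calculus of variations. -/
theorem eq_zero_of_forall_pair_eq_zero (hO : IsOpen O) (hA : Sm O A)
    (h : ∀ φ, Test O φ → pair A φ = 0) : ∀ t x, (t, x) ∈ O → A t x = 0 := by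
  have hae : ∀ᵐ z : ℝ × ℝ, z ∈ O → Function.uncurry A z = 0 := by
    refine hO.ae_eq_zero_of_integral_contDiff_smul_eq_zero
      (hA.continuousOn.locallyIntegrableOn hO.measurableSet) fun g hg hs ht => ?_
    have := h (fun s y => g (s, y)) ⟨hg, hs, ht⟩
    rw [← this]
    exact integral_congr_ae (Eventually.of_forall fun z => by simp [Function.uncurry, mul_comm])
  have := Measure.eqOn_open_of_ae_eq (μ := volume) (U := O) (f := Function.uncurry A)
    (g := fun _ => (0 : ℝ)) ((ae_restrict_iff' hO.measurableSet).2 hae) hO hA.continuousOn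
    continuousOn_const
  exact fun t x hz => this hz

end TestFunctions

/-! ### The linearization of F and its self-adjointness -/

section SelfAdjoint

/-- The partial derivative `∂F/∂u_x`. -/
def waveFp (k c R p r s y : ℝ) : ℝ :=
  c ^ 2 * ((k - 1) * p ^ (k - 2) * r
    + (1 / 6 * (k - 1) * (k - 2) * R ^ 2) * ((k - 3) * p ^ (k - 4)) * r ^ 3
    + (2 / 3 * (k - 1) * R ^ 2) * ((k - 2) * p ^ (k - 3)) * r * s
    + (1 / 3 * R ^ 2) * ((k - 1) * p ^ (k - 2)) * y)

/-- The partial derivative `∂F/∂u_xx`. -/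
def waveFr (k c R p r s : ℝ) : ℝ :=
  c ^ 2 * (p ^ (k - 1) + (1 / 6 * (k - 1) * (k - 2) * R ^ 2) * p ^ (k - 3) * (3 * r ^ 2)
    + (2 / 3 * (k - 1) * R ^ 2) * p ^ (k - 2) * s)

/-- The partial derivative `∂F/∂u_xxx`. -/
def waveFs (k c R p r : ℝ) : ℝ := c ^ 2 * ((2 / 3 * (k - 1) * R ^ 2) * p ^ (k - 2) * r)

/-- The partial derivative `∂F/∂u_xxxx`. -/
def waveFy (k c R p : ℝ) : ℝ := c ^ 2 * ((1 / 3 * R ^ 2) * p ^ (k - 1))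

theorem hasDerivAt_waveF {k c R : ℝ} {p r s y : ℝ → ℝ} {p' r' s' y' e : ℝ} (hpos : 0 < p e)
    (hp : HasDerivAt p p' e) (hr : HasDerivAt r r' e) (hs : HasDerivAt s s' e)
    (hy : HasDerivAt y y' e) :
    HasDerivAt (fun e => waveF k c R (p e) (r e) (s e) (y e))
      (waveFp k c R (p e) (r e) (s e) (y e) * p' + waveFr k c R (p e) (r e) (s e) * r'
        + waveFs k c R (p e) (r e) * s' + waveFy k c R (p e) * y') e := by
  have hP (n : ℝ) := hp.rpow_const (p := n) (Or.inl hpos.ne')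
  refine ((((((hP (k - 1)).mul hr).add
    (((hP (k - 3)).const_mul (1 / 6 * (k - 1) * (k - 2) * R ^ 2)).mul (hr.pow 3))).add
    ((((hP (k - 2)).const_mul (2 / 3 * (k - 1) * R ^ 2)).mul hr).mul hs)).add
    (((hP (k - 1)).const_mul (1 / 3 * R ^ 2)).mul hy)).const_mul (c ^ 2)).congr_deriv ?_
  simp only [waveFp, waveFr, waveFs, waveFy, show k - 1 - 1 = k - 2 by ring,
    show k - 2 - 1 = k - 3 by ring, show k - 3 - 1 = k - 4 by ring, Pi.mul_apply, Pi.pow_apply]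
  simp [-mul_eq_mul_left_iff, -mul_eq_mul_right_iff]
  ring

/-- The linearization of `F` at `u`, applied to `η`. -/
def linF (k c R : ℝ) (u η : ℝ → ℝ → ℝ) (t x : ℝ) : ℝ :=
  waveFp k c R (pd 0 1 u t x) (pd 0 2 u t x) (pd 0 3 u t x) (pd 0 4 u t x) * pd 0 1 η t x
    + waveFr k c R (pd 0 1 u t x) (pd 0 2 u t x) (pd 0 3 u t x) * pd 0 2 η t x
    + waveFs k c R (pd 0 1 u t x) (pd 0 2 u t x) * pd 0 3 η t x
    + waveFy k c R (pd 0 1 u t x) * pd 0 4 η t x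

/-- The second-order coefficient of the linearization of `F` in divergence form. -/
def linCoeff (k c R p r s : ℝ) : ℝ :=
  -(c ^ 2 * ((1 / 6 * (k - 1) * (k - 2) * R ^ 2) * p ^ (k - 3) * r ^ 2
    + (1 / 3 * (k - 1) * R ^ 2) * p ^ (k - 2) * s + p ^ (k - 1)))

variable {k c R : ℝ} {O : Set (ℝ × ℝ)} {u η φ A : ℝ → ℝ → ℝ} {t x : ℝ}

/-- F is the variational derivative of `lagrangian₀` = L₀(p, r), so its linearization is the Jacobi
operator η ↦ D_x²(b η_xx) - D_x(a η_x) of the second variation. Here b = ∂²L₀/∂r² is `waveFy`, and a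
= ∂²L₀/∂p² - D_x(∂²L₀/∂p∂r) is `linCoeff`. -/
theorem linF_eq_divergence (hO : IsOpen O) (hu : Sm O u)
    (hp : ∀ t x, (t, x) ∈ O → 0 < pd 0 1 u t x) (hη : Sm O η) (h : (t, x) ∈ O) :
    linF k c R u η t x
      = Dx (Dx (fun s y => waveFy k c R (pd 0 1 u s y) * Dx (Dx η) s y)) t x
        - Dx (fun s y => linCoeff k c R (pd 0 1 u s y) (pd 0 2 u s y) (pd 0 3 u s y)
            * Dx η s y) t x := by
  have e1 : Dx η = pd 0 1 η := by rw [pd_zero_succ, pd_zero_zero]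
  have e2 : Dx (Dx η) = pd 0 2 η := by rw [pd_zero_succ, pd_zero_succ, pd_zero_zero]
  rw [e2, e1]
  have hP : ∀ s y, (s, y) ∈ O → ∀ n : ℝ, HasDerivAt (fun y => pd 0 1 u s y ^ n) _ y :=
    fun s y hs n => (hu.hasDerivAt_pd_x hO hs 0 1).rpow_const (p := n) (Or.inl (hp s y hs).ne')
  have d1 : ∀ s y, (s, y) ∈ O → Dx (fun s y => waveFy k c R (pd 0 1 u s y) * pd 0 2 η s y) s y
      = c ^ 2 * ((1 / 3 * R ^ 2) * ((k - 1) * pd 0 1 u s y ^ (k - 2) * pd 0 2 u s y))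
          * pd 0 2 η s y
        + c ^ 2 * ((1 / 3 * R ^ 2) * pd 0 1 u s y ^ (k - 1)) * pd 0 3 η s y := by
    intro s y hs
    refine ((((((hP s y hs (k - 1)).const_mul (1 / 3 * R ^ 2)).const_mul (c ^ 2))).mul
      (hη.hasDerivAt_pd_x hO hs 0 2)).congr_deriv ?_).deriv
    simp only [show k - 1 - 1 = k - 2 by ring]
    ring
  have d2 := ((((((((hP t x h (k - 2)).const_mul (k - 1)).mul
    (hu.hasDerivAt_pd_x hO h 0 2)).const_mul (1 / 3 * R ^ 2)).const_mul (c ^ 2)).mul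
    (hη.hasDerivAt_pd_x hO h 0 2)).add
    ((((hP t x h (k - 1)).const_mul (1 / 3 * R ^ 2)).const_mul (c ^ 2)).mul
      (hη.hasDerivAt_pd_x hO h 0 3)))).deriv
  have d3 := (((((((hP t x h (k - 3)).const_mul (1 / 6 * (k - 1) * (k - 2) * R ^ 2)).mul
    ((hu.hasDerivAt_pd_x hO h 0 2).pow 2)).add
    (((hP t x h (k - 2)).const_mul (1 / 3 * (k - 1) * R ^ 2)).mul
      (hu.hasDerivAt_pd_x hO h 0 3))).add (hP t x h (k - 1))).const_mul (c ^ 2)).neg.mul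
    (hη.hasDerivAt_pd_x hO h 0 1)).deriv
  have d3' : Dx (fun s y => linCoeff k c R (pd 0 1 u s y) (pd 0 2 u s y) (pd 0 3 u s y)
      * pd 0 1 η s y) t x = _ := d3
  have d2' : Dx (fun s y => c ^ 2 * ((1 / 3 * R ^ 2) * ((k - 1) * pd 0 1 u s y ^ (k - 2)
      * pd 0 2 u s y)) * pd 0 2 η s y
        + c ^ 2 * ((1 / 3 * R ^ 2) * pd 0 1 u s y ^ (k - 1)) * pd 0 3 η s y) t x = _ := d2
  rw [Dx_congr hO d1 h, d2', d3']
  simp only [linF, waveFp, waveFr, waveFs, waveFy, show k - 1 - 1 = k - 2 by ring,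
    show k - 2 - 1 = k - 3 by ring, show k - 3 - 1 = k - 4 by ring, Pi.mul_apply, Pi.pow_apply,
    Pi.add_apply, Pi.neg_apply]
  simp [-mul_eq_mul_left_iff, -mul_eq_mul_right_iff]
  ring

theorem Sm.waveFy (hO : IsOpen O) (hu : Sm O u)
    (hp : ∀ t x, (t, x) ∈ O → 0 < HNWave.pd 0 1 u t x) :
    Sm O (fun s y => waveFy k c R (HNWave.pd 0 1 u s y)) := by
  have h1 := contDiffOn_rpow_const (Sm.pd hO hu 0 1) (fun z hz => hp z.1 z.2 hz) (k - 1)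
  exact contDiffOn_const.mul (contDiffOn_const.mul h1)

theorem Sm.linCoeff (hO : IsOpen O) (hu : Sm O u)
    (hp : ∀ t x, (t, x) ∈ O → 0 < HNWave.pd 0 1 u t x) :
    Sm O (fun s y => linCoeff k c R (HNWave.pd 0 1 u s y) (HNWave.pd 0 2 u s y)
      (HNWave.pd 0 3 u s y)) := by
  have hP := contDiffOn_rpow_const (Sm.pd hO hu 0 1) (fun z hz => hp z.1 z.2 hz)
  exact (contDiffOn_const.mul ((((contDiffOn_const.mul (hP (k - 3))).mul
    (ContDiffOn.pow (Sm.pd hO hu 0 2) 2)).add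
    ((contDiffOn_const.mul (hP (k - 2))).mul (Sm.pd hO hu 0 3))).add (hP (k - 1)))).neg

theorem Sm.linF (hO : IsOpen O) (hu : Sm O u)
    (hp : ∀ t x, (t, x) ∈ O → 0 < HNWave.pd 0 1 u t x) (hη : Sm O η) :
    Sm O (linF k c R u η) :=
  ContDiffOn.congr
    ((((hu.waveFy (k := k) (c := c) (R := R) hO hp).mul ((hη.Dx hO).Dx hO)).Dx hO).Dx hO |>.sub
      (((hu.linCoeff (k := k) (c := c) (R := R) hO hp).mul (hη.Dx hO)).Dx hO))
    fun _ hz => linF_eq_divergence hO hu hp hη hz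

/-- The linearization of `F` is formally self-adjoint. -/
theorem pair_linF (hO : IsOpen O) (hu : Sm O u)
    (hp : ∀ t x, (t, x) ∈ O → 0 < pd 0 1 u t x) (hA : Sm O A) (hφ : Test O φ) :
    pair A (linF k c R u φ) = pair (linF k c R u A) φ := by
  have hb := hu.waveFy (k := k) (c := c) (R := R) hO hp
  have ha := hu.linCoeff (k := k) (c := c) (R := R) hO hp
  have hφ1 := hφ.Dx hO
  have hφ2 := hφ1.Dx hO
  have hA1 := hA.Dx hO
  have hA2 := hA1.Dx hO
  have hbφ := Test.mul hO hb hφ2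
  have haφ := Test.mul hO ha hφ1
  have hbA := hb.mul hA2
  have haA := ha.mul hA1
  have h1 : pair A (linF k c R u φ)
      = pair A (Dx (Dx (fun s y => waveFy k c R (pd 0 1 u s y) * Dx (Dx φ) s y)))
        - pair A (Dx (fun s y => linCoeff k c R (pd 0 1 u s y) (pd 0 2 u s y) (pd 0 3 u s y)
            * Dx φ s y)) := by
    unfold pair
    rw [← integral_sub (Test.mul hO hA ((hbφ.Dx hO).Dx hO)).integrable
      (Test.mul hO hA (haφ.Dx hO)).integrable]
    refine integral_congr_ae (Eventually.of_forall fun z => ?_)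
    by_cases hz : z ∈ tsupport (Function.uncurry φ)
    · dsimp only
      rw [linF_eq_divergence hO hu hp hφ.smOn (hφ.2.2 hz), mul_sub]
    · have z0 : ∀ i, pd 0 i φ z.1 z.2 = 0 := fun i => by
        have := pd_congr (f := φ) (g := fun _ _ => 0)
          (isClosed_tsupport (Function.uncurry φ)).isOpen_compl
          (fun s y hs => hφ.eq_zero hs) 0 i z.1 z.2 hz
        rw [this]; simp [pd]
      have n1 : ∀ {B ψ : ℝ → ℝ → ℝ}, z ∉ tsupport (Function.uncurry ψ) →
          z ∉ tsupport (Function.uncurry fun s y => B s y * ψ s y) := fun {B ψ} hn h' =>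
        hn (tsupport_mul_subset_right (f := Function.uncurry B) h')
      have n2 : ∀ {ψ : ℝ → ℝ → ℝ}, Test O ψ → z ∉ tsupport (Function.uncurry ψ) →
          z ∉ tsupport (Function.uncurry (Dx ψ)) := fun {ψ} hψ hn h' => by
        refine hn (closure_minimal (fun w hw => ?_) (isClosed_tsupport _) h')
        by_contra hw'
        exact hw (hψ.Dx_eq_zero hw')
      have m1 := n2 hφ hz
      have m2 := n2 hφ1 m1
      have m3 := n2 hbφ (n1 m2)
      simp only [linF, z0]
      rw [(hbφ.Dx hO).Dx_eq_zero m3, haφ.Dx_eq_zero (n1 m1)]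
      ring
  -- Two integrations by parts on each side of multiplication by b, and one on each side of
  -- multiplication by a; multiplication is symmetric and the signs cancel in pairs.
  rw [h1, pair_Dx hO hA (hbφ.Dx hO), pair_Dx hO hA1 hbφ, pair_mul_right, pair_Dx hO hbA hφ1,
    pair_Dx hO (hbA.Dx hO) hφ, pair_Dx hO hA haφ, pair_mul_right, pair_Dx hO haA hφ]
  simp only [neg_neg]
  unfold pair
  rw [← integral_sub (Test.mul hO ((hbA.Dx hO).Dx hO) hφ).integrable
    (Test.mul hO (haA.Dx hO) hφ).integrable]
  refine integral_congr_ae (Eventually.of_forall fun z => ?_)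
  by_cases hz : z ∈ tsupport (Function.uncurry φ)
  · dsimp only
    rw [linF_eq_divergence hO hu hp hA (hφ.2.2 hz), sub_mul]
  · simp [hφ.eq_zero (t := z.1) (x := z.2) hz]

end SelfAdjoint

/-! ### From multipliers to the determining equation -/

section Euler

variable {k c R : ℝ} {U : Set FirstJet} {Q A : FirstJet → ℝ} {O : Set (ℝ × ℝ)}
  {u φ : ℝ → ℝ → ℝ} {t x : ℝ}

theorem Sm.comp_firstJet (hO : IsOpen O) (hu : Sm O u)
    (hj : ∀ t x, (t, x) ∈ O → firstJet u t x ∈ U) (hA : ContDiffOn ℝ ∞ A U) :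
    Sm O (fun s y => A (firstJet u s y)) := by
  refine hA.comp (g := A) (f := fun z : ℝ × ℝ => firstJet u z.1 z.2) ?_ fun z hz => hj _ _ hz
  exact contDiffOn_fst.prodMk (contDiffOn_snd.prodMk (ContDiffOn.prodMk hu
    (ContDiffOn.prodMk (Sm.pd hO hu 0 1) (Sm.pd hO hu 1 0))))

theorem Sm.comp_jet {N : ℕ} {T : Jet N → ℝ} (hO : IsOpen O) (hu : Sm O u)
    (hj : ∀ t x, (t, x) ∈ O → firstJet u t x ∈ U) (hT : ContDiffOn ℝ ∞ T (jetDomain N U)) :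
    Sm O (fun s y => T (jet N u s y)) := by
  refine hT.comp (g := T) (f := fun z : ℝ × ℝ => jet N u z.1 z.2) ?_ fun z hz => ?_
  · refine contDiffOn_fst.prodMk (contDiffOn_snd.prodMk ?_)
    exact contDiffOn_pi.2 fun i => contDiffOn_pi.2 fun j => Sm.pd hO hu i j
  · have := hj _ _ hz
    rw [firstJet, ← congrFun (congrFun (pd_zero_zero u) z.1) z.2] at this
    exact this

theorem Sm.waveOp (hO : IsOpen O) (hu : Sm O u)
    (hp : ∀ t x, (t, x) ∈ O → 0 < HNWave.pd 0 1 u t x) : Sm O (waveOp k c R u) := by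
  have hP := contDiffOn_rpow_const (Sm.pd hO hu 0 1) (fun z hz => hp z.1 z.2 hz)
  have h1 := Sm.pd hO hu 0 2
  have h2 := Sm.pd hO hu 0 3
  have h3 := Sm.pd hO hu 0 4
  exact ContDiffOn.sub (Sm.pd hO hu 2 0) (contDiffOn_const.mul
    (((((hP (k - 1)).mul h1).add ((contDiffOn_const.mul (hP (k - 3))).mul (h1.pow 3))).add
      (((contDiffOn_const.mul (hP (k - 2))).mul h1).mul h2)).add
        ((contDiffOn_const.mul (hP (k - 1))).mul h3)))

/-- The integral of a total divergence does not see compactly supported perturbations. -/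
theorem IsMultiplier.integral_eq (hQ : IsMultiplier k c R U Q) {O K : Set (ℝ × ℝ)}
    {w : ℝ → ℝ → ℝ} (hO : IsOpen O) (hK : IsCompact K) (hKO : K ⊆ O) (hu : SmoothOn U O u)
    (hw : SmoothOn U O w) (huw : ∀ t x, (t, x) ∉ K → w t x = u t x) :
    ∫ z in K, waveOp k c R w z.1 z.2 * Q (firstJet w z.1 z.2)
      = ∫ z in K, waveOp k c R u z.1 z.2 * Q (firstJet u z.1 z.2) := by
  obtain ⟨-, N, T, X, hT, hX, hTX⟩ := hQ
  have sT := (Sm.comp_jet hO hu.2.1 hu.2.2 hT)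
  have sX := (Sm.comp_jet hO hu.2.1 hu.2.2 hX)
  have sT' := (Sm.comp_jet hO hw.2.1 hw.2.2 hT)
  have sX' := (Sm.comp_jet hO hw.2.1 hw.2.2 hX)
  have hjet : ∀ t x, (t, x) ∉ K → jet N w t x = jet N u t x := by
    intro t x hz
    simp only [jet, Prod.mk.injEq, true_and]
    funext i j
    exact pd_congr hK.isClosed.isOpen_compl (fun s y hs => huw s y hs) i j t x hz
  -- Off K the functions agree on an open set, hence so do their jets. The differences of density
  -- and flux are therefore test functions, and the integrals of their derivatives vanish.
  have dT : Test O (fun s y => T (jet N w s y) - T (jet N u s y)) :=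
    test_of_eq_zero hO hK hKO (sT'.sub sT) fun t x hz => by rw [hjet t x hz, sub_self]
  have dX : Test O (fun s y => X (jet N w s y) - X (jet N u s y)) :=
    test_of_eq_zero hO hK hKO (sX'.sub sX) fun t x hz => by rw [hjet t x hz, sub_self]
  have hsupp : ∀ {f g : ℝ → ℝ → ℝ}, (∀ t x, (t, x) ∉ K → f t x = g t x) → ∀ z, z ∉ K →
      z ∉ tsupport (Function.uncurry fun s y => f s y - g s y) := by
    intro f g hfg z hz h'
    refine hz (closure_minimal (fun y hy => ?_) hK.isClosed h')
    by_contra hy'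
    exact hy (sub_eq_zero.2 (hfg y.1 y.2 hy'))
  -- Continuity of the integrand is read off from its divergence form, in which T and X are smooth.
  have cont : ∀ {v : ℝ → ℝ → ℝ}, SmoothOn U O v → IntegrableOn
      (fun z : ℝ × ℝ => waveOp k c R v z.1 z.2 * Q (firstJet v z.1 z.2)) K := by
    intro v hv
    refine ContinuousOn.integrableOn_compact hK ?_
    have := (((Sm.comp_jet hO hv.2.1 hv.2.2 hT).Dt hO).add
      ((Sm.comp_jet hO hv.2.1 hv.2.2 hX).Dx hO)).continuousOn
    exact (this.congr fun z hz => (hTX O v hv z.1 z.2 hz).symm).mono hKO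
  rw [← sub_eq_zero, ← integral_sub (cont hw) (cont hu)]
  have e : ∀ z ∈ K, waveOp k c R w z.1 z.2 * Q (firstJet w z.1 z.2)
      - waveOp k c R u z.1 z.2 * Q (firstJet u z.1 z.2)
      = Dt (fun s y => T (jet N w s y) - T (jet N u s y)) z.1 z.2
        + Dx (fun s y => X (jet N w s y) - X (jet N u s y)) z.1 z.2 := by
    intro z hz
    rw [← hTX O w hw z.1 z.2 (hKO hz), ← hTX O u hu z.1 z.2 (hKO hz),
      Dx_sub hO sX' sX (hKO hz)]
    have : Dt (fun s y => T (jet N w s y) - T (jet N u s y)) z.1 z.2 = _ :=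
      ((sT'.hasDerivAt_t hO (hKO hz)).sub (sT.hasDerivAt_t hO (hKO hz))).deriv
    rw [this]; ring
  rw [setIntegral_congr_fun hK.measurableSet e, setIntegral_eq_integral_of_forall_compl_eq_zero,
    integral_add (dT.Dt hO).integrable (dX.Dx hO).integrable, dT.integral_Dt, dX.integral_Dx,
    add_zero]
  intro z hz
  rw [dT.Dt_eq_zero (hsupp (fun t x h => by rw [hjet t x h]) z hz),
    dX.Dx_eq_zero (hsupp (fun t x h => by rw [hjet t x h]) z hz), add_zero]

/-- The first-order jet of `u + e φ`, affine in `e`. -/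
def varJet (u φ : ℝ → ℝ → ℝ) (w : ℝ × ℝ × ℝ) : FirstJet :=
  (w.2.1, w.2.2, u w.2.1 w.2.2 + w.1 * φ w.2.1 w.2.2,
    pd 0 1 u w.2.1 w.2.2 + w.1 * pd 0 1 φ w.2.1 w.2.2,
    pd 1 0 u w.2.1 w.2.2 + w.1 * pd 1 0 φ w.2.1 w.2.2)

/-- The expression `(u_tt - F) Q` evaluated on `u + e φ`. -/
def varOp (k c R : ℝ) (Q : FirstJet → ℝ) (u φ : ℝ → ℝ → ℝ) (w : ℝ × ℝ × ℝ) : ℝ :=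
  (pd 2 0 u w.2.1 w.2.2 + w.1 * pd 2 0 φ w.2.1 w.2.2
    - waveF k c R (pd 0 1 u w.2.1 w.2.2 + w.1 * pd 0 1 φ w.2.1 w.2.2)
        (pd 0 2 u w.2.1 w.2.2 + w.1 * pd 0 2 φ w.2.1 w.2.2)
        (pd 0 3 u w.2.1 w.2.2 + w.1 * pd 0 3 φ w.2.1 w.2.2)
        (pd 0 4 u w.2.1 w.2.2 + w.1 * pd 0 4 φ w.2.1 w.2.2)) * Q (varJet u φ w)

theorem varJet_eq (hO : IsOpen O) (hu : Sm O u) (hφ : Sm O φ) (e : ℝ) (h : (t, x) ∈ O) :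
    varJet u φ (e, t, x) = firstJet (fun s y => u s y + e * φ s y) t x := by
  simp only [varJet, firstJet, pd_add_const_mul hO hu hφ e _ _ t x h]

theorem varOp_eq (hO : IsOpen O) (hu : Sm O u) (hφ : Sm O φ) (e : ℝ) (h : (t, x) ∈ O) :
    varOp k c R Q u φ (e, t, x) = waveOp k c R (fun s y => u s y + e * φ s y) t x
      * Q (firstJet (fun s y => u s y + e * φ s y) t x) := by
  simp only [varOp, varJet_eq hO hu hφ e h, waveOp, pd_add_const_mul hO hu hφ e _ _ t x h]

/-- The derivative of `(u_tt - F) Q` along `u + e φ` at `e = 0`. -/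
theorem hasDerivAt_varOp (hU : IsOpen U) (hQ : ContDiffOn ℝ ∞ Q U)
    (hj : firstJet u t x ∈ U) (hp : 0 < pd 0 1 u t x) :
    HasDerivAt (fun e => varOp k c R Q u φ (e, t, x))
      ((pd 2 0 φ t x - linF k c R u φ t x) * Q (firstJet u t x)
        + waveOp k c R u t x * (fderiv ℝ Q (firstJet u t x) (0, 0, 1, 0, 0) * φ t x
          + fderiv ℝ Q (firstJet u t x) (0, 0, 0, 1, 0) * pd 0 1 φ t x
          + fderiv ℝ Q (firstJet u t x) (0, 0, 0, 0, 1) * pd 1 0 φ t x)) 0 := by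
  have lin : ∀ a b : ℝ, HasDerivAt (fun e : ℝ => a + e * b) b 0 := fun a b => by
    simpa using ((hasDerivAt_id (0 : ℝ)).mul_const b).const_add a
  have hF := hasDerivAt_waveF (k := k) (c := c) (R := R) (e := (0 : ℝ)) (by simpa using hp)
    (lin (pd 0 1 u t x) (pd 0 1 φ t x))
    (lin (pd 0 2 u t x) (pd 0 2 φ t x)) (lin (pd 0 3 u t x) (pd 0 3 φ t x))
    (lin (pd 0 4 u t x) (pd 0 4 φ t x))
  have hJ : HasDerivAt (fun e : ℝ => varJet u φ (e, t, x))
      ((0, 0, φ t x, pd 0 1 φ t x, pd 1 0 φ t x) : FirstJet) 0 :=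
    (hasDerivAt_const _ _).prodMk ((hasDerivAt_const _ _).prodMk ((lin (u t x) (φ t x)).prodMk
      ((lin (pd 0 1 u t x) (pd 0 1 φ t x)).prodMk (lin (pd 1 0 u t x) (pd 1 0 φ t x)))))
  have hJ0 : varJet u φ (0, t, x) = firstJet u t x := by simp [varJet, firstJet]
  have hQ' : HasFDerivAt Q (fderiv ℝ Q (firstJet u t x)) (varJet u φ (0, t, x)) := by
    rw [hJ0]
    exact ((hQ.contDiffAt (hU.mem_nhds hj)).differentiableAt (by simp)).hasFDerivAt
  have hdir : fderiv ℝ Q (firstJet u t x) (0, 0, φ t x, pd 0 1 φ t x, pd 1 0 φ t x)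
      = fderiv ℝ Q (firstJet u t x) (0, 0, 1, 0, 0) * φ t x
          + fderiv ℝ Q (firstJet u t x) (0, 0, 0, 1, 0) * pd 0 1 φ t x
          + fderiv ℝ Q (firstJet u t x) (0, 0, 0, 0, 1) * pd 1 0 φ t x := by
    have : ((0, 0, φ t x, pd 0 1 φ t x, pd 1 0 φ t x) : FirstJet)
        = φ t x • (0, 0, 1, 0, 0) + pd 0 1 φ t x • (0, 0, 0, 1, 0)
          + pd 1 0 φ t x • (0, 0, 0, 0, 1) := by simp
    rw [this]; simp only [map_add, map_smul, smul_eq_mul]; ring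
  have := ((lin (pd 2 0 u t x) (pd 2 0 φ t x)).sub hF).mul (hQ'.comp_hasDerivAt 0 hJ)
  rw [hdir] at this
  refine this.congr_deriv ?_
  simp [linF, waveOp, hJ0]

/-- The first variation of `∫ (u_tt - F) Q` vanishes if `Q` is a multiplier. -/
theorem IsMultiplier.integral_variation_eq_zero (hU : IsOpen U) (hUp : U ⊆ posStrain)
    (hQ : IsMultiplier k c R U Q) (hu : SmoothOn U O u) (hφ : Test O φ) :
    ∫ z in tsupport (Function.uncurry φ),
      ((pd 2 0 φ z.1 z.2 - linF k c R u φ z.1 z.2) * Q (firstJet u z.1 z.2)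
        + waveOp k c R u z.1 z.2 * (fderiv ℝ Q (firstJet u z.1 z.2) (0, 0, 1, 0, 0) * φ z.1 z.2
          + fderiv ℝ Q (firstJet u z.1 z.2) (0, 0, 0, 1, 0) * pd 0 1 φ z.1 z.2
          + fderiv ℝ Q (firstJet u z.1 z.2) (0, 0, 0, 0, 1) * pd 1 0 φ z.1 z.2)) = 0 := by
  obtain ⟨hO, hu', hj⟩ := hu
  have hus : Sm O u := hu'
  have hφs : Sm O φ := hφ.smOn
  have hOO : IsOpen ((univ : Set ℝ) ×ˢ O) := isOpen_univ.prod hO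
  have lift : ∀ {f : ℝ → ℝ → ℝ}, Sm O f →
      ContDiffOn ℝ ∞ (fun w : ℝ × ℝ × ℝ => f w.2.1 w.2.2) (univ ×ˢ O) := fun {f} hf =>
    ContDiffOn.comp (g := Function.uncurry f) hf (f := fun w : ℝ × ℝ × ℝ => w.2)
      contDiffOn_snd fun w hw => hw.2
  have aff : ∀ i j, ContDiffOn ℝ ∞ (fun w : ℝ × ℝ × ℝ =>
      pd i j u w.2.1 w.2.2 + w.1 * pd i j φ w.2.1 w.2.2) (univ ×ˢ O) := fun i j =>
    (lift (hus.pd hO i j)).add (contDiffOn_fst.mul (lift (hφs.pd hO i j)))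
  have hvJ : ContDiffOn ℝ ∞ (varJet u φ) (univ ×ˢ O) := by
    refine ContDiffOn.prodMk (ContDiff.contDiffOn (by fun_prop)) (ContDiffOn.prodMk
      (ContDiff.contDiffOn (by fun_prop)) (ContDiffOn.prodMk ?_ ((aff 0 1).prodMk (aff 1 0))))
    exact (lift hus).add (contDiffOn_fst.mul (lift hφs))
  -- For large e the jets of u + eφ may leave U. W collects the (e, t, x) at which they do not; it
  -- is open and contains {0} times the support of φ.
  set W : Set (ℝ × ℝ × ℝ) := (univ ×ˢ O) ∩ varJet u φ ⁻¹' U with hWdef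
  have hW : IsOpen W := hvJ.continuousOn.isOpen_inter_preimage hOO hU
  have hWO : W ⊆ univ ×ˢ O := inter_subset_left
  have hΦ : ContDiffOn ℝ ∞ (varOp k c R Q u φ) W := by
    have hP := contDiffOn_rpow_const ((aff 0 1).mono hWO) (fun w hw => hUp hw.2)
    have h1 := (aff 0 2).mono hWO
    refine ContDiffOn.mul (((aff 2 0).mono hWO).sub (contDiffOn_const.mul
      (((((hP (k - 1)).mul h1).add ((contDiffOn_const.mul (hP (k - 3))).mul (h1.pow 3))).add
      (((contDiffOn_const.mul (hP (k - 2))).mul h1).mul ((aff 0 3).mono hWO))).add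
        ((contDiffOn_const.mul (hP (k - 1))).mul ((aff 0 4).mono hWO))))) ?_
    exact hQ.1.comp (hvJ.mono hWO) fun w hw => hw.2
  have hK : IsCompact (tsupport (Function.uncurry φ)) := hφ.2.1.isCompact
  have hKW : ({0} : Set ℝ) ×ˢ tsupport (Function.uncurry φ) ⊆ W := by
    rintro ⟨e, z⟩ ⟨rfl, hz⟩
    refine ⟨⟨mem_univ _, hφ.2.2 hz⟩, ?_⟩
    have : varJet u φ (0, z) = firstJet u z.1 z.2 := by simp [varJet, firstJet]
    rw [mem_preimage, this]; exact hj z.1 z.2 (hφ.2.2 hz)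
  have hder := hasDerivAt_setIntegral_of_contDiffOn volume hK hW (hΦ.of_le (by norm_cast)) hKW
  -- By the tube lemma, for every e near 0 the slice of W at e contains the support of φ and u + eφ
  -- is admissible on that slice; so the integral is locally constant in e and its derivative at 0
  -- vanishes.
  have hconst : (fun e => ∫ z in tsupport (Function.uncurry φ), varOp k c R Q u φ (e, z))
      =ᶠ[𝓝 0] fun _ => ∫ z in tsupport (Function.uncurry φ), varOp k c R Q u φ (0, z) := by
    obtain ⟨a, b, ha, -, h0a, hKb, hab⟩ :=
      generalized_tube_lemma isCompact_singleton hK hW hKW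
    have key : ∀ e ∈ a, ∫ z in tsupport (Function.uncurry φ), varOp k c R Q u φ (e, z)
        = ∫ z in tsupport (Function.uncurry φ),
            waveOp k c R u z.1 z.2 * Q (firstJet u z.1 z.2) := by
      intro e he
      set O' : Set (ℝ × ℝ) := (fun z => (e, z)) ⁻¹' W with hO'def
      have hO' : IsOpen O' := hW.preimage (by fun_prop)
      have hO'O : O' ⊆ O := fun z hz => (hWO hz).2
      have hsum : Sm O' (fun s y => u s y + e * φ s y) :=
        (hus.mono hO'O).add (contDiffOn_const.mul (ContDiffOn.mono hφs hO'O))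
      rw [← hQ.integral_eq (w := fun s y => u s y + e * φ s y) hO' hK
        (fun z hz => hab ⟨he, hKb hz⟩)
        ⟨hO', hus.mono hO'O, fun t x h => hj t x (hO'O h)⟩
        ⟨hO', hsum, fun t x h => by
          rw [← varJet_eq hO hus hφs e (hO'O h)]; exact h.2⟩
        (fun t x h => by rw [hφ.eq_zero h]; ring)]
      exact setIntegral_congr_fun hK.measurableSet fun z hz =>
        varOp_eq hO hus hφs e (hφ.2.2 hz)
    filter_upwards [ha.mem_nhds (h0a rfl)] with e he
    rw [key e he, key 0 (h0a rfl)]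
  have h0 := hder.unique ((hasDerivAt_const (0 : ℝ) _).congr_of_eventuallyEq hconst)
  refine Eq.trans ?_ h0
  refine setIntegral_congr_fun hK.measurableSet fun z hz => ?_
  have hd : DifferentiableAt ℝ (varOp k c R Q u φ) (0, z) :=
    (hΦ.contDiffAt (hW.mem_nhds (hKW ⟨mem_singleton _, hz⟩))).differentiableAt (by simp)
  have h1 := hd.hasFDerivAt.comp_hasDerivAt (0 : ℝ) (f := fun s : ℝ => (s, z))
    ((hasDerivAt_id (0 : ℝ)).prodMk (hasDerivAt_const (0 : ℝ) z))
  have hjz := hj z.1 z.2 (hφ.2.2 hz)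
  exact (hasDerivAt_varOp hU hQ.1 hjz (hUp hjz)).unique h1

/-- The sign σ lets one splitting serve twice: with 1 before the integrations by parts and with -1
after them. -/
theorem integral_sub_add_mul_add_mul {a₁ a₂ a₃ a₄ a₅ : ℝ × ℝ → ℝ} (σ : ℝ) (h₁ : Integrable a₁)
    (h₂ : Integrable a₂) (h₃ : Integrable a₃) (h₄ : Integrable a₄) (h₅ : Integrable a₅) :
    ∫ z, (a₁ z - a₂ z + a₃ z + σ * a₄ z + σ * a₅ z)
      = (∫ z, a₁ z) - (∫ z, a₂ z) + (∫ z, a₃ z) + σ * (∫ z, a₄ z) + σ * (∫ z, a₅ z) := by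
  have i₂ : Integrable fun z => a₁ z - a₂ z := h₁.sub h₂
  have i₃ : Integrable fun z => a₁ z - a₂ z + a₃ z := i₂.add h₃
  have i₄ : Integrable fun z => a₁ z - a₂ z + a₃ z + σ * a₄ z := i₃.add (h₄.const_mul σ)
  rw [integral_add i₄ (h₅.const_mul σ), integral_add i₃ (h₄.const_mul σ), integral_add i₂ h₃,
    integral_sub h₁ h₂, integral_const_mul, integral_const_mul]

/-- The determining equation of multipliers: the Euler operator annihilates `(u_tt - F) Q`. -/
theorem IsMultiplier.euler_eq_zero (hU : IsOpen U) (hUp : U ⊆ posStrain)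
    (hQ : IsMultiplier k c R U Q) (hu : SmoothOn U O u) (h : (t, x) ∈ O) :
    Dt (Dt fun s y => Q (firstJet u s y)) t x
      - linF k c R u (fun s y => Q (firstJet u s y)) t x
      + waveOp k c R u t x * fderiv ℝ Q (firstJet u t x) (0, 0, 1, 0, 0)
      - Dx (fun s y => waveOp k c R u s y * fderiv ℝ Q (firstJet u s y) (0, 0, 0, 1, 0)) t x
      - Dt (fun s y => waveOp k c R u s y * fderiv ℝ Q (firstJet u s y) (0, 0, 0, 0, 1)) t x
      = 0 := by
  have hO := hu.1
  have hus : Sm O u := hu.2.1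
  have hp : ∀ t x, (t, x) ∈ O → 0 < pd 0 1 u t x := fun t x h => hUp (hu.2.2 t x h)
  have hQs : Sm O (fun s y => Q (firstJet u s y)) := hus.comp_firstJet hO hu.2.2 hQ.1
  have hG : Sm O (waveOp k c R u) := hus.waveOp hO hp
  have hd : ∀ v, Sm O (fun s y => fderiv ℝ Q (firstJet u s y) v) := fun v =>
    hus.comp_firstJet (A := fun z => fderiv ℝ Q z v) hO hu.2.2 (contDiffOn_fderiv_apply hU hQ.1 v)
  have s1 := (hQs.Dt hO).Dt hO
  have s2 := hus.linF (k := k) (c := c) (R := R) hO hp hQs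
  have s3 := hG.mul (hd (0, 0, 1, 0, 0))
  have s4 := hG.mul (hd (0, 0, 0, 1, 0))
  have s5 := hG.mul (hd (0, 0, 0, 0, 1))
  refine eq_zero_of_forall_pair_eq_zero (A := fun s y => Dt (Dt fun s y => Q (firstJet u s y)) s y
      - linF k c R u (fun s y => Q (firstJet u s y)) s y
      + waveOp k c R u s y * fderiv ℝ Q (firstJet u s y) (0, 0, 1, 0, 0)
      - Dx (fun s y => waveOp k c R u s y * fderiv ℝ Q (firstJet u s y) (0, 0, 0, 1, 0)) s y
      - Dt (fun s y => waveOp k c R u s y * fderiv ℝ Q (firstJet u s y) (0, 0, 0, 0, 1)) s y)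
    hO ((((s1.sub s2).add s3).sub (s4.Dx hO)).sub (s5.Dt hO)) (fun φ hφ => ?_) t x h
  have hz := hQ.integral_variation_eq_zero hU hUp hu hφ
  have p10 : pd 1 0 φ = Dt φ := by rw [pd_succ_left, pd_zero_zero]
  have p20 : pd 2 0 φ = Dt (Dt φ) := by rw [pd_succ_left, p10]
  have p01 : pd 0 1 φ = Dx φ := by rw [pd_zero_succ, pd_zero_zero]
  have hLφ : Test O (linF k c R u φ) := by
    refine test_of_eq_zero hO hφ.2.1 hφ.2.2 (hus.linF hO hp hφ.smOn) fun t x hz => ?_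
    have z0 : ∀ i, pd 0 i φ t x = 0 := fun i => by
      rw [pd_congr (f := φ) (g := fun _ _ => 0)
        (isClosed_tsupport (Function.uncurry φ)).isOpen_compl
        (fun s y hs => hφ.eq_zero hs) 0 i t x hz]; simp [pd]
    simp [linF, z0]
  rw [setIntegral_eq_integral_of_forall_compl_eq_zero] at hz
  swap
  · intro z hz
    have z0 : ∀ i j, pd i j φ z.1 z.2 = 0 := fun i j => by
      rw [pd_congr (f := φ) (g := fun _ _ => 0)
        (isClosed_tsupport (Function.uncurry φ)).isOpen_compl
        (fun s y hs => hφ.eq_zero hs) i j z.1 z.2 hz]; simp [pd]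
    simp [linF, z0, hφ.eq_zero (t := z.1) (x := z.2) hz]
  have i1 := (Test.mul hO hQs ((hφ.Dt hO).Dt hO)).integrable
  have i2 := (Test.mul hO hQs hLφ).integrable
  have i3 := (Test.mul hO s3 hφ).integrable
  have i4 := (Test.mul hO s4 (hφ.Dx hO)).integrable
  have i5 := (Test.mul hO s5 (hφ.Dt hO)).integrable
  have hsplit : pair (fun s y => Q (firstJet u s y)) (Dt (Dt φ))
      - pair (fun s y => Q (firstJet u s y)) (linF k c R u φ)
      + pair (fun s y => waveOp k c R u s y * fderiv ℝ Q (firstJet u s y) (0, 0, 1, 0, 0)) φ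
      + pair (fun s y => waveOp k c R u s y * fderiv ℝ Q (firstJet u s y) (0, 0, 0, 1, 0)) (Dx φ)
      + pair (fun s y => waveOp k c R u s y * fderiv ℝ Q (firstJet u s y) (0, 0, 0, 0, 1)) (Dt φ)
      = 0 := by
    have e := integral_sub_add_mul_add_mul 1 i1 i2 i3 i4 i5
    simp only [one_mul] at e
    refine e.symm.trans (Eq.trans ?_ hz)
    refine integral_congr_ae (Eventually.of_forall fun z => ?_)
    simp only [p10, p20, p01]
    ring
  -- Every derivative is moved off φ. Those of even order keep their sign, and `linF` passes to Q by
  -- self-adjointness.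
  rw [pair_Dt hO hQs (hφ.Dt hO), pair_Dt hO (hQs.Dt hO) hφ, pair_linF hO hus hp hQs hφ,
    pair_Dx hO s4 hφ, pair_Dt hO s5 hφ] at hsplit
  have j1 := (Test.mul hO s1 hφ).integrable
  have j2 := (Test.mul hO s2 hφ).integrable
  have j4 := (Test.mul hO (s4.Dx hO) hφ).integrable
  have j5 := (Test.mul hO (s5.Dt hO) hφ).integrable
  have e := integral_sub_add_mul_add_mul (-1) j1 j2 i3 j4 j5
  refine Eq.trans ?_ (e.trans ?_)
  · refine integral_congr_ae (Eventually.of_forall fun z => ?_)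
    ring
  · refine Eq.trans ?_ hsplit
    simp only [neg_neg, neg_one_mul]
    rfl

end Euler

/-! ### Differentiation in the first-order jet coordinates -/

section JetCalculus

/-- The coordinate vectors of the first-order jet space. -/
def jvec (i : Fin 5) : FirstJet :=
  ![(1, 0, 0, 0, 0), (0, 1, 0, 0, 0), (0, 0, 1, 0, 0), (0, 0, 0, 1, 0), (0, 0, 0, 0, 1)] i

/-- The partial derivative of a function of the first-order jet in one of the coordinates
`t, x, u, u_x, u_t`. -/
def jd (i : Fin 5) (A : FirstJet → ℝ) (z : FirstJet) : ℝ := fderiv ℝ A z (jvec i)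

variable {U : Set FirstJet} {A : FirstJet → ℝ} {z : FirstJet}

theorem fderiv_apply_eq_sum_jd (A : FirstJet → ℝ) (z : FirstJet) (a b c d e : ℝ) :
    fderiv ℝ A z (a, b, c, d, e)
      = a * jd 0 A z + b * jd 1 A z + c * jd 2 A z + d * jd 3 A z + e * jd 4 A z := by
  have : ((a, b, c, d, e) : FirstJet)
      = a • jvec 0 + b • jvec 1 + c • jvec 2 + d • jvec 3 + e • jvec 4 := by simp [jvec]
  rw [this]; simp only [map_add, map_smul, smul_eq_mul, jd]

theorem contDiffOn_jd (hU : IsOpen U) (hA : ContDiffOn ℝ ∞ A U) (i : Fin 5) :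
    ContDiffOn ℝ ∞ (jd i A) U := contDiffOn_fderiv_apply hU hA _

theorem jd_comm (hU : IsOpen U) (hA : ContDiffOn ℝ ∞ A U) (hz : z ∈ U) (i j : Fin 5) :
    jd i (jd j A) z = jd j (jd i A) z := fderiv_fderiv_apply_comm hU hA hz _ _

theorem jd_congr {B : FirstJet → ℝ} (hU : IsOpen U) (h : ∀ z ∈ U, A z = B z) (hz : z ∈ U)
    (i : Fin 5) : jd i A z = jd i B z := by
  have : A =ᶠ[𝓝 z] B := by filter_upwards [hU.mem_nhds hz] with w hw using h w hw
  simp only [jd, this.fderiv_eq]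

theorem jd_eq_zero (hU : IsOpen U) (h : ∀ z ∈ U, A z = 0) (hz : z ∈ U) (i : Fin 5) :
    jd i A z = 0 := by
  rw [jd_congr (B := fun _ => 0) hU h hz]; simp [jd]

theorem hasDerivAt_comp_curve (hU : IsOpen U) (hA : ContDiffOn ℝ ∞ A U) {j : ℝ → FirstJet}
    {e a b c d f : ℝ} (hj : HasDerivAt j (a, b, c, d, f) e) (hz : j e ∈ U) :
    HasDerivAt (fun s => A (j s)) (a * jd 0 A (j e) + b * jd 1 A (j e) + c * jd 2 A (j e)
      + d * jd 3 A (j e) + f * jd 4 A (j e)) e := by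
  rw [← fderiv_apply_eq_sum_jd]
  exact ((hA.contDiffAt (hU.mem_nhds hz)).differentiableAt (by simp)).hasFDerivAt.comp_hasDerivAt
    e hj

theorem hasDerivAt_line (hU : IsOpen U) (hA : ContDiffOn ℝ ∞ A U) (hz : z ∈ U) (i : Fin 5) :
    HasDerivAt (fun s : ℝ => A (z + s • jvec i)) (jd i A z) 0 := by
  have hl : HasDerivAt (fun s : ℝ => z + s • jvec i) (jvec i) 0 := by
    simpa using ((hasDerivAt_id (0 : ℝ)).smul_const (jvec i)).const_add z
  have hz' : z + (0 : ℝ) • jvec i = z := by simp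
  have := ((hA.contDiffAt (hU.mem_nhds hz)).differentiableAt (by simp)).hasFDerivAt
  rw [← hz'] at this
  have h2 := this.comp_hasDerivAt (0 : ℝ) hl
  rw [hz'] at h2
  exact h2

/-- An identity valid on all of the open set U may be differentiated in any jet coordinate; the
determining equations are differentiated in this way. -/
theorem eq_zero_of_hasDerivAt_line (hU : IsOpen U) (hA : ∀ z ∈ U, A z = 0) (hz : z ∈ U)
    (i : Fin 5) {d : ℝ} (h : HasDerivAt (fun s : ℝ => A (z + s • jvec i)) d 0) : d = 0 := by
  refine h.unique ((hasDerivAt_const (0 : ℝ) (0 : ℝ)).congr_of_eventuallyEq ?_)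
  have hc : ContinuousAt (fun s : ℝ => z + s • jvec i) 0 := by fun_prop
  exact (hc.eventually (hU.mem_nhds (by simpa using hz))).mono fun s hs => hA _ hs

end JetCalculus

/-! ### The determining equation on polynomials with prescribed jet -/

section TestFunction

/-- A polynomial with prescribed jet at `(t₀, x₀)`. -/
def testFun (t₀ x₀ u₀ p q r y m h t x : ℝ) : ℝ :=
  u₀ + p * (x - x₀) + r * (x - x₀) ^ 2 / 2 + y * (x - x₀) ^ 4 / 24
    + (t - t₀) * (q + m * (x - x₀)) + h * (t - t₀) ^ 2 / 2

variable (t₀ x₀ u₀ p q r y m h : ℝ)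

theorem hasDerivAt_sub_pow (a x : ℝ) (n : ℕ) :
    HasDerivAt (fun x => (x - a) ^ n) (n * (x - a) ^ (n - 1)) x :=
  (((hasDerivAt_id x).sub_const a).pow n).congr_deriv (by simp)

theorem hasDerivAt_sub (a x : ℝ) : HasDerivAt (fun x => x - a) 1 x :=
  (hasDerivAt_id x).sub_const a

theorem pd_testFun_zero_one : pd 0 1 (testFun t₀ x₀ u₀ p q r y m h)
    = fun t x => p + r * (x - x₀) + y * (x - x₀) ^ 3 / 6 + m * (t - t₀) := by
  funext t x
  rw [pd_zero_succ, pd_zero_zero]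
  refine (((((((((hasDerivAt_sub x₀ x).const_mul p).const_add u₀).add
    (((hasDerivAt_sub_pow x₀ x 2).const_mul r).div_const 2)).add
    (((hasDerivAt_sub_pow x₀ x 4).const_mul y).div_const 24)).add
    ((((hasDerivAt_sub x₀ x).const_mul m).const_add q).const_mul (t - t₀))).add_const
      (h * (t - t₀) ^ 2 / 2))).congr_deriv ?_).deriv
  norm_num; ring

theorem pd_testFun_zero_two : pd 0 2 (testFun t₀ x₀ u₀ p q r y m h)
    = fun _ x => r + y * (x - x₀) ^ 2 / 2 := by
  funext t x
  rw [pd_zero_succ, pd_testFun_zero_one]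
  refine ((((((hasDerivAt_sub x₀ x).const_mul r).const_add p).add
    (((hasDerivAt_sub_pow x₀ x 3).const_mul y).div_const 6)).add_const
      (m * (t - t₀))).congr_deriv ?_).deriv
  norm_num; ring

theorem pd_testFun_zero_three : pd 0 3 (testFun t₀ x₀ u₀ p q r y m h)
    = fun _ x => y * (x - x₀) := by
  funext t x
  rw [pd_zero_succ, pd_testFun_zero_two]
  refine (((((hasDerivAt_sub_pow x₀ x 2).const_mul y).div_const 2).const_add r).congr_deriv
    ?_).deriv
  norm_num; ring

theorem pd_testFun_zero_four : pd 0 4 (testFun t₀ x₀ u₀ p q r y m h) = fun _ _ => y := by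
  funext t x
  rw [pd_zero_succ, pd_testFun_zero_three]
  refine (((hasDerivAt_sub x₀ x).const_mul y).congr_deriv ?_).deriv
  ring

theorem pd_testFun_one_zero : pd 1 0 (testFun t₀ x₀ u₀ p q r y m h)
    = fun t x => q + m * (x - x₀) + h * (t - t₀) := by
  funext t x
  rw [pd_succ_left, pd_zero_zero]
  refine (((((hasDerivAt_sub t₀ t).mul_const (q + m * (x - x₀))).const_add
    (u₀ + p * (x - x₀) + r * (x - x₀) ^ 2 / 2 + y * (x - x₀) ^ 4 / 24)).add
    (((hasDerivAt_sub_pow t₀ t 2).const_mul h).div_const 2)).congr_deriv ?_).deriv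
  norm_num; ring

theorem pd_testFun_two_zero : pd 2 0 (testFun t₀ x₀ u₀ p q r y m h) = fun _ _ => h := by
  funext t x
  rw [pd_succ_left, pd_testFun_one_zero]
  refine ((((hasDerivAt_sub t₀ t).const_mul h).const_add (q + m * (x - x₀))).congr_deriv ?_).deriv
  ring

theorem sm_testFun (O : Set (ℝ × ℝ)) : Sm O (testFun t₀ x₀ u₀ p q r y m h) := by
  refine ContDiff.contDiffOn ?_
  unfold Function.uncurry testFun
  fun_prop

/-- The first-order jet of the test function along `t = t₀`. -/
def testCurve (x : ℝ) : FirstJet :=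
  (t₀, x, u₀ + p * (x - x₀) + r * (x - x₀) ^ 2 / 2 + y * (x - x₀) ^ 4 / 24,
    p + r * (x - x₀) + y * (x - x₀) ^ 3 / 6, q + m * (x - x₀))

theorem firstJet_testFun (x : ℝ) :
    firstJet (testFun t₀ x₀ u₀ p q r y m h) t₀ x = testCurve t₀ x₀ u₀ p q r y m x := by
  simp [firstJet, testCurve, pd_testFun_zero_one, pd_testFun_one_zero, testFun]

theorem testCurve_self : testCurve t₀ x₀ u₀ p q r y m x₀ = (t₀, x₀, u₀, p, q) := by
  simp [testCurve]

theorem hasDerivAt_firstJet_testFun_t (t x : ℝ) :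
    HasDerivAt (fun s => firstJet (testFun t₀ x₀ u₀ p q r y m h) s x)
      ((1, 0, q + m * (x - x₀) + h * (t - t₀), m, h) : FirstJet) t := by
  have h0 := (sm_testFun t₀ x₀ u₀ p q r y m h univ).hasDerivAt_pd_t isOpen_univ
    (mem_univ (t, x)) 0 0
  simp only [pd_zero_zero, zero_add, pd_testFun_one_zero] at h0
  have h1 : HasDerivAt (fun s => pd 0 1 (testFun t₀ x₀ u₀ p q r y m h) s x) m t := by
    rw [pd_testFun_zero_one]
    simpa using ((hasDerivAt_sub t₀ t).const_mul m).const_add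
      (p + r * (x - x₀) + y * (x - x₀) ^ 3 / 6)
  have h2 : HasDerivAt (fun s => pd 1 0 (testFun t₀ x₀ u₀ p q r y m h) s x) h t := by
    rw [pd_testFun_one_zero]
    simpa using ((hasDerivAt_sub t₀ t).const_mul h).const_add (q + m * (x - x₀))
  exact (hasDerivAt_id t).prodMk ((hasDerivAt_const _ _).prodMk (h0.prodMk (h1.prodMk h2)))

theorem hasDerivAt_testCurve (x : ℝ) :
    HasDerivAt (testCurve t₀ x₀ u₀ p q r y m)
      ((0, 1, p + r * (x - x₀) + y * (x - x₀) ^ 3 / 6, r + y * (x - x₀) ^ 2 / 2, m) : FirstJet)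
      x := by
  refine (hasDerivAt_const _ _).prodMk ((hasDerivAt_id x).prodMk (HasDerivAt.prodMk ?_
    (HasDerivAt.prodMk ?_ ?_)))
  · refine (((((hasDerivAt_sub x₀ x).const_mul p).const_add u₀).add
      (((hasDerivAt_sub_pow x₀ x 2).const_mul r).div_const 2)).add
      (((hasDerivAt_sub_pow x₀ x 4).const_mul y).div_const 24)).congr_deriv ?_
    norm_num; ring
  · refine ((((hasDerivAt_sub x₀ x).const_mul r).const_add p).add
      (((hasDerivAt_sub_pow x₀ x 3).const_mul y).div_const 6)).congr_deriv ?_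
    norm_num; ring
  · simpa using ((hasDerivAt_sub x₀ x).const_mul m).const_add q

variable {k c R t₀ x₀ u₀ p q r y m h} {U : Set FirstJet} {Q : FirstJet → ℝ}

/-- The determining equation evaluated on the test function. -/
theorem IsMultiplier.euler_testFun (hU : IsOpen U) (hUp : U ⊆ posStrain)
    (hQ : IsMultiplier k c R U Q) {z : FirstJet} (hz : z ∈ U) (hze : z = (t₀, x₀, u₀, p, q)) :
    (jd 0 (jd 0 Q) z + q * jd 2 (jd 0 Q) z + m * jd 3 (jd 0 Q) z + h * jd 4 (jd 0 Q) z)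
      + q * (jd 0 (jd 2 Q) z + q * jd 2 (jd 2 Q) z + m * jd 3 (jd 2 Q) z + h * jd 4 (jd 2 Q) z)
      + h * jd 2 Q z
      + m * (jd 0 (jd 3 Q) z + q * jd 2 (jd 3 Q) z + m * jd 3 (jd 3 Q) z + h * jd 4 (jd 3 Q) z)
      + h * (jd 0 (jd 4 Q) z + q * jd 2 (jd 4 Q) z + m * jd 3 (jd 4 Q) z + h * jd 4 (jd 4 Q) z)
      - (waveFp k c R p r 0 y
          * iteratedDeriv 1 (fun x => Q (testCurve t₀ x₀ u₀ p q r y m x)) x₀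
        + waveFr k c R p r 0
          * iteratedDeriv 2 (fun x => Q (testCurve t₀ x₀ u₀ p q r y m x)) x₀
        + waveFs k c R p r
          * iteratedDeriv 3 (fun x => Q (testCurve t₀ x₀ u₀ p q r y m x)) x₀
        + waveFy k c R p
          * iteratedDeriv 4 (fun x => Q (testCurve t₀ x₀ u₀ p q r y m x)) x₀)
      + (h - waveF k c R p r 0 y) * jd 2 Q z
      - (-(waveFp k c R p r 0 y * r + waveFs k c R p r * y) * jd 3 Q z
        + (h - waveF k c R p r 0 y) * (jd 1 (jd 3 Q) z + p * jd 2 (jd 3 Q) z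
            + r * jd 3 (jd 3 Q) z + m * jd 4 (jd 3 Q) z))
      - (-(waveFp k c R p r 0 y * m) * jd 4 Q z
        + (h - waveF k c R p r 0 y) * (jd 0 (jd 4 Q) z + q * jd 2 (jd 4 Q) z
            + m * jd 3 (jd 4 Q) z + h * jd 4 (jd 4 Q) z)) = 0 := by
  set u := testFun t₀ x₀ u₀ p q r y m h with hu
  have hp : 0 < p := by have := hUp hz; rw [hze] at this; exact this
  have hus : Sm univ u := sm_testFun t₀ x₀ u₀ p q r y m h univ
  have hjc : Continuous fun z : ℝ × ℝ => firstJet u z.1 z.2 := by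
    have h0 := hus.continuousOn
    have h1 := (hus.pd isOpen_univ 0 1).continuousOn
    have h2 := (hus.pd isOpen_univ 1 0).continuousOn
    rw [← continuousOn_univ]
    exact continuousOn_fst.prodMk (continuousOn_snd.prodMk (h0.prodMk (h1.prodMk h2)))
  -- The polynomial is defined everywhere but is admissible only where its jets lie in U.
  set O : Set (ℝ × ℝ) := (fun z : ℝ × ℝ => firstJet u z.1 z.2) ⁻¹' U with hOdef
  have hO : IsOpen O := hU.preimage hjc
  have hj0 : firstJet u t₀ x₀ = z := by rw [hu, firstJet_testFun, testCurve_self, hze]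
  have hO0 : (t₀, x₀) ∈ O := by
    change firstJet u t₀ x₀ ∈ U
    rwa [hj0]
  have key := hQ.euler_eq_zero hU hUp (O := O) (u := u) (t := t₀) (x := x₀)
    ⟨hO, hus.mono (subset_univ _), fun t x h => h⟩ hO0
  have hdt : ∀ {A : FirstJet → ℝ}, ContDiffOn ℝ ∞ A U → ∀ s x, (s, x) ∈ O →
      HasDerivAt (fun s => A (firstJet u s x)) _ s := fun {A} hA s x hs =>
    hasDerivAt_comp_curve hU hA (hasDerivAt_firstJet_testFun_t t₀ x₀ u₀ p q r y m h s x) hs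
  have hcurve : (fun x => firstJet u t₀ x) = testCurve t₀ x₀ u₀ p q r y m :=
    funext fun x => firstJet_testFun t₀ x₀ u₀ p q r y m h x
  have hdx : ∀ {A : FirstJet → ℝ}, ContDiffOn ℝ ∞ A U →
      HasDerivAt (fun x => A (firstJet u t₀ x)) _ x₀ := fun {A} hA =>
    hasDerivAt_comp_curve hU hA (j := fun x => firstJet u t₀ x) (by
      rw [hcurve]; exact hasDerivAt_testCurve t₀ x₀ u₀ p q r y m x₀) hO0
  have hD := fun i => contDiffOn_jd hU hQ.1 i
  have e20 : ∀ s x, pd 2 0 u s x = h := fun s x => by rw [hu, pd_testFun_two_zero]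
  have e01 : ∀ s x, pd 0 1 u s x = p + r * (x - x₀) + y * (x - x₀) ^ 3 / 6 + m * (s - t₀) :=
    fun s x => by rw [hu, pd_testFun_zero_one]
  have e02 : ∀ s x, pd 0 2 u s x = r + y * (x - x₀) ^ 2 / 2 :=
    fun s x => by rw [hu, pd_testFun_zero_two]
  -- The polynomial has no cubic term in x, so u_xxx vanishes at the base point; this is the 0 in
  -- the third argument slots.
  have e03 : ∀ s x, pd 0 3 u s x = y * (x - x₀) :=
    fun s x => by rw [hu, pd_testFun_zero_three]
  have e04 : ∀ s x, pd 0 4 u s x = y := fun s x => by rw [hu, pd_testFun_zero_four]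
  have hGt : HasDerivAt (fun s => waveOp k c R u s x₀) (-(waveFp k c R p r 0 y * m)) t₀ := by
    have := hasDerivAt_waveF (k := k) (c := c) (R := R) (e := t₀)
      (p := fun s => pd 0 1 u s x₀) (r := fun s => pd 0 2 u s x₀) (s := fun s => pd 0 3 u s x₀)
      (y := fun s => pd 0 4 u s x₀) (p' := m) (r' := 0) (s' := 0) (y' := 0) (by simpa [e01])
      (by simp only [e01]; simpa using ((hasDerivAt_sub t₀ t₀).const_mul m).const_add
            (p + r * (x₀ - x₀) + y * (x₀ - x₀) ^ 3 / 6))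
      (by simp only [e02]; exact hasDerivAt_const _ _)
      (by simp only [e03]; exact hasDerivAt_const _ _)
      (by simp only [e04]; exact hasDerivAt_const _ _)
    have h2 := this.const_sub h
    simp only [e01, e02, e03, e04] at h2
    unfold waveOp
    simp only [e20, e01, e02, e03, e04]
    refine h2.congr_deriv ?_
    simp
  have hGx : HasDerivAt (fun x => waveOp k c R u t₀ x)
      (-(waveFp k c R p r 0 y * r + waveFs k c R p r * y)) x₀ := by
    have := hasDerivAt_waveF (k := k) (c := c) (R := R) (e := x₀)
      (p := fun s => pd 0 1 u t₀ s) (r := fun s => pd 0 2 u t₀ s) (s := fun s => pd 0 3 u t₀ s)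
      (y := fun s => pd 0 4 u t₀ s) (by simpa [e01])
      (hus.hasDerivAt_pd_x isOpen_univ (mem_univ _) 0 1)
      (hus.hasDerivAt_pd_x isOpen_univ (mem_univ _) 0 2)
      (hus.hasDerivAt_pd_x isOpen_univ (mem_univ _) 0 3) (y' := 0)
      (by simp only [e04]; exact hasDerivAt_const _ _)
    have h2 := this.const_sub h
    simp only [e01, e02, e03, e04, Nat.reduceAdd] at h2
    unfold waveOp
    simp only [e20, e01, e02, e03, e04]
    refine h2.congr_deriv ?_
    simp
  have hG0 : waveOp k c R u t₀ x₀ = h - waveF k c R p r 0 y := by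
    simp [waveOp, e20, e01, e02, e03, e04]
  have e1 : ∀ s x, (s, x) ∈ O → Dt (fun s y => Q (firstJet u s y)) s x
      = jd 0 Q (firstJet u s x) + (q + m * (x - x₀) + h * (s - t₀)) * jd 2 Q (firstJet u s x)
        + m * jd 3 Q (firstJet u s x) + h * jd 4 Q (firstJet u s x) := by
    intro s x hs
    refine (hdt hQ.1 s x hs).deriv.trans ?_
    ring
  have t1 : Dt (fun s x => jd 0 Q (firstJet u s x)
      + (q + m * (x - x₀) + h * (s - t₀)) * jd 2 Q (firstJet u s x)
      + m * jd 3 Q (firstJet u s x) + h * jd 4 Q (firstJet u s x)) t₀ x₀ = _ :=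
    ((((hdt (hD 0) t₀ x₀ hO0).add
      ((((hasDerivAt_sub t₀ t₀).const_mul h).const_add (q + m * (x₀ - x₀))).mul
        (hdt (hD 2) t₀ x₀ hO0))).add
      ((hdt (hD 3) t₀ x₀ hO0).const_mul m)).add ((hdt (hD 4) t₀ x₀ hO0).const_mul h)).deriv
  have t4 : Dx (fun s y => waveOp k c R u s y * jd 3 Q (firstJet u s y)) t₀ x₀ = _ :=
    (hGx.mul (hdx (hD 3))).deriv
  have t5 : Dt (fun s y => waveOp k c R u s y * jd 4 Q (firstJet u s y)) t₀ x₀ = _ :=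
    (hGt.mul (hdt (hD 4) t₀ x₀ hO0)).deriv
  have hq : ∀ i, pd 0 i (fun s y => Q (firstJet u s y)) t₀ x₀
      = iteratedDeriv i (fun x => Q (testCurve t₀ x₀ u₀ p q r y m x)) x₀ := by
    intro i
    rw [← hcurve]; simp [pd]
  change _ - _ + _ * jd 2 Q (firstJet u t₀ x₀)
    - Dx (fun s y => waveOp k c R u s y * jd 3 Q (firstJet u s y)) t₀ x₀
    - Dt (fun s y => waveOp k c R u s y * jd 4 Q (firstJet u s y)) t₀ x₀ = 0 at key
  rw [Dt_congr hO e1 hO0, t1, t4, t5] at key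
  simp only [linF, hq, hG0, hj0, e01, e02, e03, e04] at key
  simp only [sub_self] at key
  norm_num at key
  norm_num
  linear_combination key

end TestFunction

/-! ### The coefficient of u_tt -/

section Determining

variable {k c R : ℝ} {U : Set FirstJet} {Q : FirstJet → ℝ} {z : FirstJet}

/-- The two h² Q_qq terms cancel, so the determining equation is affine in h = u_tt, and the
difference of its values at h = 1 and h = 0 is the coefficient of h. -/
theorem IsMultiplier.coeff_utt (hU : IsOpen U) (hUp : U ⊆ posStrain)
    (hQ : IsMultiplier k c R U Q) (hz : z ∈ U) (r y : ℝ) :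
    jd 0 (jd 4 Q) z + z.2.2.2.2 * jd 2 (jd 4 Q) z + 2 * jd 2 Q z - jd 1 (jd 3 Q) z
      - z.2.2.2.1 * jd 2 (jd 3 Q) z - r * jd 3 (jd 3 Q) z
      + waveF k c R z.2.2.2.1 r 0 y * jd 4 (jd 4 Q) z = 0 := by
  obtain ⟨t₀, x₀, u₀, p, q⟩ := z
  have e1 := hQ.euler_testFun hU hUp hz rfl (r := r) (y := y) (m := 0) (h := 1)
  have e0 := hQ.euler_testFun hU hUp hz rfl (r := r) (y := y) (m := 0) (h := 0)
  have c0 := jd_comm hU hQ.1 hz 4 0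
  have c2 := jd_comm hU hQ.1 hz 4 2
  dsimp only
  linear_combination e1 - e0 - c0 - q * c2

theorem waveFy_pos (hc : 0 < c) (hR : 0 < R) {p : ℝ} (hp : 0 < p) : 0 < waveFy k c R p := by
  have := Real.rpow_pos_of_pos hp (k - 1)
  unfold waveFy; positivity

/-- In the coefficient of u_tt, y = u_xxxx occurs only through F Q_qq, and ∂F/∂u_xxxx > 0 because c
and R are nonzero. -/
theorem IsMultiplier.qq_eq_zero (hc : 0 < c) (hR : 0 < R) (hU : IsOpen U) (hUp : U ⊆ posStrain)
    (hQ : IsMultiplier k c R U Q) : ∀ z ∈ U, jd 4 (jd 4 Q) z = 0 := by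
  intro z hz
  have e1 := hQ.coeff_utt hU hUp hz 0 1
  have e0 := hQ.coeff_utt hU hUp hz 0 0
  have hF : waveF k c R z.2.2.2.1 0 0 1 - waveF k c R z.2.2.2.1 0 0 0
      = waveFy k c R z.2.2.2.1 := by simp [waveF, waveFy]
  have hpos := waveFy_pos (k := k) hc hR (hUp hz)
  have : waveFy k c R z.2.2.2.1 * jd 4 (jd 4 Q) z = 0 := by
    rw [← hF]; linear_combination e1 - e0
  exact (mul_eq_zero.1 this).resolve_left hpos.ne'

/-- With Q_qq = 0 the function F drops out, and -Q_pp is all that multiplies r = u_xx. -/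
theorem IsMultiplier.pp_eq_zero (hc : 0 < c) (hR : 0 < R) (hU : IsOpen U) (hUp : U ⊆ posStrain)
    (hQ : IsMultiplier k c R U Q) : ∀ z ∈ U, jd 3 (jd 3 Q) z = 0 := by
  intro z hz
  have e1 := hQ.coeff_utt hU hUp hz 1 0
  have e0 := hQ.coeff_utt hU hUp hz 0 0
  have h := hQ.qq_eq_zero hc hR hU hUp z hz
  rw [h] at e0 e1
  linear_combination e0 - e1

theorem IsMultiplier.first_order_eq (hc : 0 < c) (hR : 0 < R) (hU : IsOpen U)
    (hUp : U ⊆ posStrain) (hQ : IsMultiplier k c R U Q) :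
    ∀ z ∈ U, jd 0 (jd 4 Q) z + z.2.2.2.2 * jd 2 (jd 4 Q) z + 2 * jd 2 Q z - jd 1 (jd 3 Q) z
      - z.2.2.2.1 * jd 2 (jd 3 Q) z = 0 := by
  intro z hz
  have e0 := hQ.coeff_utt hU hUp hz 0 0
  rw [hQ.qq_eq_zero hc hR hU hUp z hz] at e0
  linear_combination e0

end Determining

/-! ### Iterated x-derivatives of Q along the jet of the polynomial -/

section Curve

variable {U : Set FirstJet} {A Q : FirstJet → ℝ} {t₀ x₀ u₀ p q r y m : ℝ}

theorem continuous_testCurve : Continuous (testCurve t₀ x₀ u₀ p q r y m) :=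
  continuous_iff_continuousAt.2 fun x =>
    (hasDerivAt_testCurve t₀ x₀ u₀ p q r y m x).continuousAt

theorem isOpen_testCurve_preimage (hU : IsOpen U) :
    IsOpen (testCurve t₀ x₀ u₀ p q r y m ⁻¹' U) := hU.preimage continuous_testCurve

theorem hasDerivAt_comp_testCurve (hU : IsOpen U) (hA : ContDiffOn ℝ ∞ A U) {x : ℝ}
    (hx : testCurve t₀ x₀ u₀ p q r y m x ∈ U) :
    HasDerivAt (fun x => A (testCurve t₀ x₀ u₀ p q r y m x))
      (jd 1 A (testCurve t₀ x₀ u₀ p q r y m x)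
        + (p + r * (x - x₀) + y * (x - x₀) ^ 3 / 6) * jd 2 A (testCurve t₀ x₀ u₀ p q r y m x)
        + (r + y * (x - x₀) ^ 2 / 2) * jd 3 A (testCurve t₀ x₀ u₀ p q r y m x)
        + m * jd 4 A (testCurve t₀ x₀ u₀ p q r y m x)) x := by
  refine (hasDerivAt_comp_curve hU hA (hasDerivAt_testCurve t₀ x₀ u₀ p q r y m x)
    hx).congr_deriv ?_
  ring

/-- The derivative in the direction of the first-order jet of a function with vanishing
`u_xx`, with `u_x = p` and `u_tx = m`. -/
def dirD (p m : ℝ) (A : FirstJet → ℝ) (z : FirstJet) : ℝ := jd 1 A z + p * jd 2 A z + m * jd 4 A z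

theorem contDiffOn_dirD (hU : IsOpen U) (hA : ContDiffOn ℝ ∞ A U) :
    ContDiffOn ℝ ∞ (dirD p m A) U :=
  ((contDiffOn_jd hU hA 1).add (contDiffOn_const.mul (contDiffOn_jd hU hA 2))).add
    (contDiffOn_const.mul (contDiffOn_jd hU hA 4))

theorem dirD_eq_zero (hU : IsOpen U) (hA : ∀ z ∈ U, A z = 0) :
    ∀ z ∈ U, dirD p m A z = 0 := fun z hz => by
  simp [dirD, jd_eq_zero hU hA hz]

/-- In `dirD` the numbers p and m are fixed constants rather than jet coordinates, so it is a
constant-coefficient operator. -/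
theorem jd_dirD (hU : IsOpen U) (hA : ContDiffOn ℝ ∞ A U) {z : FirstJet} (hz : z ∈ U)
    (i : Fin 5) : jd i (dirD p m A) z = dirD p m (jd i A) z := by
  have h := (((hasDerivAt_line hU (contDiffOn_jd hU hA 1) hz i).add
    ((hasDerivAt_line hU (contDiffOn_jd hU hA 2) hz i).const_mul p)).add
    ((hasDerivAt_line hU (contDiffOn_jd hU hA 4) hz i).const_mul m))
  have := (hasDerivAt_line hU (contDiffOn_dirD (p := p) (m := m) hU hA) hz i).unique h
  rw [this, dirD, jd_comm hU hA hz i 1, jd_comm hU hA hz i 2, jd_comm hU hA hz i 4]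

theorem iteratedDeriv_one_testCurve (hU : IsOpen U) (hA : ContDiffOn ℝ ∞ A U)
    (hz : (t₀, x₀, u₀, p, q) ∈ U) :
    iteratedDeriv 1 (fun x => A (testCurve t₀ x₀ u₀ p q r y m x)) x₀
      = dirD p m A (t₀, x₀, u₀, p, q) + r * jd 3 A (t₀, x₀, u₀, p, q) := by
  rw [iteratedDeriv_one]
  have h := hasDerivAt_comp_testCurve (t₀ := t₀) (x₀ := x₀) (u₀ := u₀) (p := p) (q := q) (r := r)
    (y := y) (m := m) (x := x₀) hU hA (by rwa [testCurve_self])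
  rw [h.deriv, testCurve_self, dirD]
  ring

/-- When r = 0, y bends the jet curve away from a straight line only at second order in its
velocity, so up to (x - x₀)² the derivative along it is `dirD`. -/
theorem eventually_hasDerivAt_flat (hU : IsOpen U) (hA : ContDiffOn ℝ ∞ A U) {x : ℝ}
    (hx : testCurve t₀ x₀ u₀ p q 0 y m x ∈ U) :
    HasDerivAt (fun x => A (testCurve t₀ x₀ u₀ p q 0 y m x))
      (dirD p m A (testCurve t₀ x₀ u₀ p q 0 y m x)
        + (x - x₀) ^ 2 * (y / 2 * jd 3 A (testCurve t₀ x₀ u₀ p q 0 y m x)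
          + y / 6 * (x - x₀) * jd 2 A (testCurve t₀ x₀ u₀ p q 0 y m x))) x := by
  refine (hasDerivAt_comp_testCurve hU hA hx).congr_deriv ?_
  rw [dirD]; ring

theorem iteratedDeriv_two_of_eventually {f f' : ℝ → ℝ} {f'' x₀ : ℝ}
    (hf : ∀ᶠ x in 𝓝 x₀, HasDerivAt f (f' x) x) (hf' : HasDerivAt f' f'' x₀) :
    iteratedDeriv 2 f x₀ = f'' := by
  have e : deriv f =ᶠ[𝓝 x₀] f' := hf.mono fun x hx => hx.deriv
  rw [iteratedDeriv_succ', iteratedDeriv_one, e.deriv_eq, hf'.deriv]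

theorem eventually_testCurve_mem (hU : IsOpen U) (hz : (t₀, x₀, u₀, p, q) ∈ U) :
    ∀ᶠ x in 𝓝 x₀, testCurve t₀ x₀ u₀ p q r y m x ∈ U :=
  (isOpen_testCurve_preimage hU).mem_nhds (by
    change testCurve t₀ x₀ u₀ p q r y m x₀ ∈ U; rwa [testCurve_self])

theorem iteratedDeriv_two_testCurve (hU : IsOpen U) (hA : ContDiffOn ℝ ∞ A U)
    (hz : (t₀, x₀, u₀, p, q) ∈ U) :
    iteratedDeriv 2 (fun x => A (testCurve t₀ x₀ u₀ p q 0 y m x)) x₀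
      = dirD p m (dirD p m A) (t₀, x₀, u₀, p, q) := by
  have hz' : testCurve t₀ x₀ u₀ p q 0 y m x₀ ∈ U := by rwa [testCurve_self]
  refine iteratedDeriv_two_of_eventually
    ((eventually_testCurve_mem hU hz).mono fun x hx => eventually_hasDerivAt_flat hU hA hx) ?_
  refine ((eventually_hasDerivAt_flat hU (contDiffOn_dirD hU hA) hz').add
    ((hasDerivAt_sub_pow x₀ x₀ 2).mul
      (((eventually_hasDerivAt_flat hU (contDiffOn_jd hU hA 3) hz').const_mul (y / 2)).add
        (((hasDerivAt_sub x₀ x₀).const_mul (y / 6)).mul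
          (eventually_hasDerivAt_flat hU (contDiffOn_jd hU hA 2) hz'))))).congr_deriv ?_
  simp [testCurve_self]

theorem iteratedDeriv_two_add_pow_mul {I : Set ℝ} (hI : IsOpen I) {x₀ : ℝ} (h₀ : x₀ ∈ I)
    {g f₁ f₂ f₃ : ℝ → ℝ} (hg : ContDiffOn ℝ ∞ g I) (h₁ : ContDiffOn ℝ ∞ f₁ I)
    (h₂ : ContDiffOn ℝ ∞ f₂ I) (h₃ : ContDiffOn ℝ ∞ f₃ I) :
    iteratedDeriv 2 (fun x => g x + (x - x₀) * f₁ x + (x - x₀) ^ 2 * f₂ x + (x - x₀) ^ 3 * f₃ x) x₀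
      = iteratedDeriv 2 g x₀ + 2 * deriv f₁ x₀ + 2 * f₂ x₀ := by
  have d : ∀ {f : ℝ → ℝ}, ContDiffOn ℝ ∞ f I → ∀ x ∈ I, HasDerivAt f (deriv f x) x :=
    fun hf x hx => ((hf.contDiffAt (hI.mem_nhds hx)).differentiableAt (by simp)).hasDerivAt
  have dd : ∀ {f : ℝ → ℝ}, ContDiffOn ℝ ∞ f I → ContDiffOn ℝ ∞ (deriv f) I :=
    fun hf => hf.deriv_of_isOpen hI (by simp)
  have hev : ∀ᶠ x in 𝓝 x₀, x ∈ I := hI.mem_nhds h₀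
  have eg : iteratedDeriv 2 g x₀ = deriv (deriv g) x₀ := by
    rw [iteratedDeriv_succ', iteratedDeriv_one]
  rw [eg]
  refine iteratedDeriv_two_of_eventually (hev.mono fun x hx =>
    (((d hg x hx).add ((hasDerivAt_sub x₀ x).mul (d h₁ x hx))).add
      ((hasDerivAt_sub_pow x₀ x 2).mul (d h₂ x hx))).add
        ((hasDerivAt_sub_pow x₀ x 3).mul (d h₃ x hx))) ?_
  refine ((((d (dd hg) x₀ h₀).add (((d h₁ x₀ h₀).const_mul 1).add
    ((hasDerivAt_sub x₀ x₀).mul (d (dd h₁) x₀ h₀)))).add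
    (((((hasDerivAt_sub_pow x₀ x₀ 1).const_mul 2)).mul (d h₂ x₀ h₀)).add
      ((hasDerivAt_sub_pow x₀ x₀ 2).mul (d (dd h₂) x₀ h₀)))).add
    (((((hasDerivAt_sub_pow x₀ x₀ 2).const_mul 3)).mul (d h₃ x₀ h₀)).add
      ((hasDerivAt_sub_pow x₀ x₀ 3).mul (d (dd h₃) x₀ h₀)))).congr_deriv ?_
  simp; ring

/-- Two differentiations by `eventually_hasDerivAt_flat` give an expression sorted by powers of x -
x₀, and `iteratedDeriv_two_add_pow_mul` evaluates the other two at x₀. The result is affine in y, so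
the coefficient of u_xxxx can be extracted. -/
theorem iteratedDeriv_four_testCurve (hU : IsOpen U) (hA : ContDiffOn ℝ ∞ A U)
    (hz : (t₀, x₀, u₀, p, q) ∈ U) :
    iteratedDeriv 4 (fun x => A (testCurve t₀ x₀ u₀ p q 0 y m x)) x₀
      = dirD p m (dirD p m (dirD p m (dirD p m A))) (t₀, x₀, u₀, p, q)
        + y * (jd 2 A (t₀, x₀, u₀, p, q) + 4 * dirD p m (jd 3 A) (t₀, x₀, u₀, p, q)) := by
  set j := testCurve t₀ x₀ u₀ p q 0 y m with hj
  have hj0 : j x₀ = (t₀, x₀, u₀, p, q) := testCurve_self ..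
  have hz' : j x₀ ∈ U := by rwa [hj0]
  have hev : ∀ᶠ x in 𝓝 x₀, j x ∈ U := eventually_testCurve_mem hU hz
  have fl : ∀ {B : FirstJet → ℝ}, ContDiffOn ℝ ∞ B U → ∀ x, j x ∈ U →
      HasDerivAt (fun x => B (j x)) (dirD p m B (j x) + (x - x₀) ^ 2 * (y / 2 * jd 3 B (j x)
          + y / 6 * (x - x₀) * jd 2 B (j x))) x := fun hB _ hx =>
    eventually_hasDerivAt_flat hU hB hx
  have h1 := contDiffOn_dirD (p := p) (m := m) hU hA
  have h2 := contDiffOn_dirD (p := p) (m := m) hU h1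
  have hp := contDiffOn_jd hU hA 3
  have hu := contDiffOn_jd hU hA 2
  have h1p := contDiffOn_jd hU h1 3
  have h1u := contDiffOn_jd hU h1 2
  -- the second derivative near the base point, up to terms of third order
  have hpp := contDiffOn_jd hU hp 3
  have hpu := contDiffOn_jd hU hp 2
  have hup := contDiffOn_jd hU hu 3
  have huu := contDiffOn_jd hU hu 2
  have hpd := contDiffOn_dirD (p := p) (m := m) hU hp
  have hud := contDiffOn_dirD (p := p) (m := m) hU hu
  have second : ∀ x, j x ∈ U → HasDerivAt (fun x => dirD p m A (j x)
      + (x - x₀) ^ 2 * (y / 2 * jd 3 A (j x) + y / 6 * (x - x₀) * jd 2 A (j x)))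
      (dirD p m (dirD p m A) (j x) + y * ((x - x₀) * jd 3 A (j x))
        + y / 2 * ((x - x₀) ^ 2 * (jd 3 (dirD p m A) (j x) + jd 2 A (j x)
            + dirD p m (jd 3 A) (j x)))
        + (x - x₀) ^ 3 * (y / 6 * jd 2 (dirD p m A) (j x) + y / 6 * dirD p m (jd 2 A) (j x)
          + (x - x₀) * (y / 2 * (y / 2 * jd 3 (jd 3 A) (j x) + y / 6 * (x - x₀) * jd 2 (jd 3 A) (j x))
            + y / 6 * (x - x₀) * (y / 2 * jd 3 (jd 2 A) (j x)
              + y / 6 * (x - x₀) * jd 2 (jd 2 A) (j x))))) x := by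
    intro x hx
    refine ((fl h1 x hx).add ((hasDerivAt_sub_pow x₀ x 2).mul (((fl hp x hx).const_mul (y / 2)).add
      (((hasDerivAt_sub x₀ x).const_mul (y / 6)).mul (fl hu x hx))))).congr_deriv ?_
    simp; ring
  have e2 : deriv (deriv fun x => A (j x)) =ᶠ[𝓝 x₀] fun x =>
      dirD p m (dirD p m A) (j x) + y * ((x - x₀) * jd 3 A (j x))
        + y / 2 * ((x - x₀) ^ 2 * (jd 3 (dirD p m A) (j x) + jd 2 A (j x)
            + dirD p m (jd 3 A) (j x)))
        + (x - x₀) ^ 3 * (y / 6 * jd 2 (dirD p m A) (j x) + y / 6 * dirD p m (jd 2 A) (j x)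
          + (x - x₀) * (y / 2 * (y / 2 * jd 3 (jd 3 A) (j x) + y / 6 * (x - x₀) * jd 2 (jd 3 A) (j x))
            + y / 6 * (x - x₀) * (y / 2 * jd 3 (jd 2 A) (j x)
              + y / 6 * (x - x₀) * jd 2 (jd 2 A) (j x)))) := by
    have e1 : deriv (fun x => A (j x)) =ᶠ[𝓝 x₀] fun x => dirD p m A (j x)
        + (x - x₀) ^ 2 * (y / 2 * jd 3 A (j x) + y / 6 * (x - x₀) * jd 2 A (j x)) :=
      hev.mono fun x hx => (fl hA x hx).deriv
    filter_upwards [hev, e1.deriv] with x hx h'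
    rw [h', (second x hx).deriv]
  have key : iteratedDeriv 4 (fun x => A (j x)) x₀
      = iteratedDeriv 2 (deriv (deriv fun x => A (j x))) x₀ := by
    rw [iteratedDeriv_succ', iteratedDeriv_succ']
  rw [key, e2.iteratedDeriv_eq 2]
  have hI : IsOpen (j ⁻¹' U) := isOpen_testCurve_preimage hU
  have hjs : ContDiff ℝ ∞ j := by rw [hj]; unfold testCurve; fun_prop
  have sm : ∀ {B : FirstJet → ℝ}, ContDiffOn ℝ ∞ B U → ContDiffOn ℝ ∞ (fun x => B (j x)) (j ⁻¹' U) :=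
    fun hB => hB.comp hjs.contDiffOn fun x hx => hx
  have lin : ∀ a : ℝ, ContDiffOn ℝ ∞ (fun x : ℝ => a * (x - x₀)) (j ⁻¹' U) := fun a =>
    ContDiff.contDiffOn (by fun_prop)
  have sub : ContDiffOn ℝ ∞ (fun x : ℝ => x - x₀) (j ⁻¹' U) := ContDiff.contDiffOn (by fun_prop)
  -- With D = `dirD`, the constant group gives D⁴A, the linear one 2y D(A_p), the quadratic one y
  -- (A_u + 2 D(A_p)), and the cubic one nothing: hence the factor 4.
  have main := iteratedDeriv_two_add_pow_mul hI hz' (sm h2)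
    (contDiffOn_const (c := y) |>.mul (sm hp))
    (contDiffOn_const (c := y / 2) |>.mul (((sm h1p).add (sm hu)).add (sm hpd)))
    (((contDiffOn_const (c := y / 6) |>.mul (sm h1u)).add
      (contDiffOn_const (c := y / 6) |>.mul (sm hud))).add
      (sub.mul ((contDiffOn_const (c := y / 2) |>.mul
          ((contDiffOn_const (c := y / 2) |>.mul (sm hpp)).add ((lin (y / 6)).mul (sm hpu)))).add
        ((lin (y / 6)).mul ((contDiffOn_const (c := y / 2) |>.mul (sm hup)).add
          ((lin (y / 6)).mul (sm huu)))))))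
  have e3 : iteratedDeriv 2 (fun x => dirD p m (dirD p m A) (j x)) x₀
      = dirD p m (dirD p m (dirD p m (dirD p m A))) (t₀, x₀, u₀, p, q) :=
    iteratedDeriv_two_testCurve hU h2 hz
  have e4 : deriv (fun x => y * jd 3 A (j x)) x₀ = y * dirD p m (jd 3 A) (t₀, x₀, u₀, p, q) := by
    rw [((fl hp x₀ hz').const_mul y).deriv, hj0]; simp
  rw [e3, e4, hj0, jd_dirD hU hA hz] at main
  refine Eq.trans (congrArg (fun f => iteratedDeriv 2 f x₀) (funext fun x => ?_)) (main.trans ?_)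
  · ring
  · ring

end Curve

/-! ### Solving the determining equations -/

section Deductions

variable {k c R : ℝ} {U : Set FirstJet} {Q : FirstJet → ℝ} {z : FirstJet}

theorem eq_zero_of_mul_left_eq_zero {a b : ℝ} (ha : a ≠ 0) (h : a * b = 0) : b = 0 :=
  (mul_eq_zero.1 h).resolve_left ha

theorem jd_ux (z : FirstJet) (i : Fin 5) :
    jd i (fun z : FirstJet => z.2.2.2.1) z = (jvec i).2.2.2.1 := by
  have h := hasDerivAt_line (A := fun z : FirstJet => z.2.2.2.1) isOpen_univ
    (ContDiff.contDiffOn (by fun_prop)) (mem_univ z) i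
  exact h.unique (by
    simpa using ((hasDerivAt_id (0 : ℝ)).mul_const (jvec i).2.2.2.1).const_add z.2.2.2.1)

theorem jd_ut (z : FirstJet) (i : Fin 5) :
    jd i (fun z : FirstJet => z.2.2.2.2) z = (jvec i).2.2.2.2 := by
  have h := hasDerivAt_line (A := fun z : FirstJet => z.2.2.2.2) isOpen_univ
    (ContDiff.contDiffOn (by fun_prop)) (mem_univ z) i
  exact h.unique (by
    simpa using ((hasDerivAt_id (0 : ℝ)).mul_const (jvec i).2.2.2.2).const_add z.2.2.2.2)

/-- The coefficient of y at r = h = 0, multiplied by p and divided by ∂F/∂u_xxxx > 0. The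
contributions m Q_q from D_xQ and from D_t(G Q_q) cancel. -/
theorem IsMultiplier.coeff_uxxxx (hc : 0 < c) (hR : 0 < R) (hU : IsOpen U) (hUp : U ⊆ posStrain)
    (hQ : IsMultiplier k c R U Q) (hz : z ∈ U) (m : ℝ) :
    -(k - 1) * (jd 1 Q z + z.2.2.2.1 * jd 2 Q z) - 2 * z.2.2.2.1 * jd 2 Q z
      - 3 * z.2.2.2.1 * (jd 1 (jd 3 Q) z + z.2.2.2.1 * jd 2 (jd 3 Q) z + m * jd 4 (jd 3 Q) z)
      + z.2.2.2.1 * (jd 0 (jd 4 Q) z + z.2.2.2.2 * jd 2 (jd 4 Q) z + m * jd 3 (jd 4 Q) z)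
      = 0 := by
  obtain ⟨t₀, x₀, u₀, p, q⟩ := z
  have hp : 0 < p := hUp hz
  have e1 := hQ.euler_testFun hU hUp hz rfl (r := 0) (y := 1) (m := m) (h := 0)
  have e0 := hQ.euler_testFun hU hUp hz rfl (r := 0) (y := 0) (m := m) (h := 0)
  rw [iteratedDeriv_one_testCurve hU hQ.1 hz, iteratedDeriv_two_testCurve hU hQ.1 hz,
    iteratedDeriv_four_testCurve hU hQ.1 hz] at e1 e0
  have hpos := waveFy_pos (k := k) hc hR hp
  have f1 : waveF k c R p 0 0 1 = waveFy k c R p := by simp [waveF, waveFy]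
  have f0 : waveF k c R p 0 0 0 = 0 := by simp [waveF]
  have g0 : waveFp k c R p 0 0 0 = 0 := by simp [waveFp]
  have s0 : waveFs k c R p 0 = 0 := by simp [waveFs]
  -- On these jets F is a multiple of p^(k-1), which is where the factor k - 1 comes from.
  have g1 : p * waveFp k c R p 0 0 1 = (k - 1) * waveFy k c R p := by
    have : p ^ (k - 1) = p ^ (k - 2) * p := by
      rw [← Real.rpow_add_one hp.ne']; ring_nf
    simp only [waveFp, waveFy, this]; ring
  rw [f1, s0] at e1
  rw [f0, g0, s0] at e0
  simp only [dirD] at e0 e1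
  dsimp only
  refine eq_zero_of_mul_left_eq_zero hpos.ne' ?_
  linear_combination p * e1 - p * e0
    + (jd 1 Q (t₀, x₀, u₀, p, q) + p * jd 2 Q (t₀, x₀, u₀, p, q)) * g1

/-- The coefficient of m = u_tx in `IsMultiplier.coeff_uxxxx` is -3p Q_pq + p Q_pq = -2p Q_pq. -/
theorem IsMultiplier.pq_eq_zero (hc : 0 < c) (hR : 0 < R) (hU : IsOpen U) (hUp : U ⊆ posStrain)
    (hQ : IsMultiplier k c R U Q) : ∀ z ∈ U, jd 3 (jd 4 Q) z = 0 := by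
  intro z hz
  have hp : 0 < z.2.2.2.1 := hUp hz
  have e1 := hQ.coeff_uxxxx hc hR hU hUp hz 1
  have e0 := hQ.coeff_uxxxx hc hR hU hUp hz 0
  have : z.2.2.2.1 * jd 3 (jd 4 Q) z = 0 := by
    rw [jd_comm hU hQ.1 hz 4 3] at e1 e0
    linear_combination (e0 - e1) / 2
  exact (mul_eq_zero.1 this).resolve_left hp.ne'

/-- The second-order derivatives of a multiplier that vanish, and its first-order determining
equations. -/
theorem IsMultiplier.second_order (hk : 1 < k) (hc : 0 < c) (hR : 0 < R) (hU : IsOpen U)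
    (hUp : U ⊆ posStrain) (hQ : IsMultiplier k c R U Q) :
    (∀ z ∈ U, jd 2 (jd 4 Q) z = 0) ∧ (∀ z ∈ U, jd 2 (jd 3 Q) z = 0) ∧
    (∀ z ∈ U, jd 2 (jd 2 Q) z = 0) ∧
    (∀ z ∈ U, jd 0 (jd 4 Q) z + 2 * jd 2 Q z - jd 1 (jd 3 Q) z = 0) ∧
    (∀ z ∈ U, jd 0 (jd 4 Q) z - (k + 1) * jd 2 Q z - (k + 2) * jd 1 (jd 3 Q) z = 0) ∧
    (∀ z ∈ U, jd 1 Q z - z.2.2.2.1 * jd 1 (jd 3 Q) z = 0) := by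
  have hk1 : k - 1 ≠ 0 := by linarith
  have s := fun i => contDiffOn_jd hU hQ.1 i
  have ss := fun i j => contDiffOn_jd hU (s j) i
  have hqq := hQ.qq_eq_zero hc hR hU hUp
  have hpp := hQ.pp_eq_zero hc hR hU hUp
  have hpq := hQ.pq_eq_zero hc hR hU hUp
  have hqp : ∀ z ∈ U, jd 4 (jd 3 Q) z = 0 := fun z hz => by
    rw [jd_comm hU hQ.1 hz]; exact hpq z hz
  have star := hQ.first_order_eq hc hR hU hUp
  have cp : ContDiffOn ℝ ∞ (fun z : FirstJet => z.2.2.2.1) U := ContDiff.contDiffOn (by fun_prop)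
  have cq : ContDiffOn ℝ ∞ (fun z : FirstJet => z.2.2.2.2) U := ContDiff.contDiffOn (by fun_prop)
  -- the derivative of `first_order_eq` in a jet coordinate
  have dstar : ∀ z ∈ U, ∀ i, jd i (jd 0 (jd 4 Q)) z
      + ((jvec i).2.2.2.2 * jd 2 (jd 4 Q) z + z.2.2.2.2 * jd i (jd 2 (jd 4 Q)) z)
      + 2 * jd i (jd 2 Q) z - jd i (jd 1 (jd 3 Q)) z
      - ((jvec i).2.2.2.1 * jd 2 (jd 3 Q) z + z.2.2.2.1 * jd i (jd 2 (jd 3 Q)) z) = 0 := by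
    intro z hz i
    have h := ((((hasDerivAt_line hU (ss 0 4) hz i).add ((hasDerivAt_line hU cq hz i).mul
      (hasDerivAt_line hU (ss 2 4) hz i))).add ((hasDerivAt_line hU (s 2) hz i).const_mul 2)).sub
      (hasDerivAt_line hU (ss 1 3) hz i)).sub ((hasDerivAt_line hU cp hz i).mul
        (hasDerivAt_line hU (ss 2 3) hz i))
    have h' := eq_zero_of_hasDerivAt_line hU star hz i h
    rw [jd_ux, jd_ut] at h'
    simpa using h'
  -- Differentiating the first-order relation in q, p and u leaves 3 Q_uq = 0, then Q_up = 0, then 2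
  -- Q_uu = 0; the third-order terms vanish by earlier equations.
  have huq : ∀ z ∈ U, jd 2 (jd 4 Q) z = 0 := fun z hz => by
    have h := dstar z hz 4
    rw [jd_comm hU (s 4) hz 4 0, jd_eq_zero hU hqq hz, jd_comm hU (s 4) hz 4 2,
      jd_eq_zero hU hqq hz, jd_comm hU (s 3) hz 4 1, jd_eq_zero hU hqp hz,
      jd_comm hU (s 3) hz 4 2, jd_eq_zero hU hqp hz, jd_comm hU hQ.1 hz 4 2] at h
    simp [jvec] at h
    linarith
  have hup : ∀ z ∈ U, jd 2 (jd 3 Q) z = 0 := fun z hz => by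
    have h := dstar z hz 3
    rw [jd_comm hU (s 4) hz 3 0, jd_eq_zero hU hpq hz, jd_comm hU (s 4) hz 3 2,
      jd_eq_zero hU hpq hz, jd_comm hU (s 3) hz 3 1, jd_eq_zero hU hpp hz,
      jd_comm hU (s 3) hz 3 2, jd_eq_zero hU hpp hz, jd_comm hU hQ.1 hz 3 2] at h
    simp [jvec] at h
    linarith
  have huu : ∀ z ∈ U, jd 2 (jd 2 Q) z = 0 := fun z hz => by
    have h := dstar z hz 2
    rw [jd_comm hU (s 4) hz 2 0, jd_eq_zero hU huq hz, jd_eq_zero hU huq hz,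
      jd_comm hU (s 3) hz 2 1, jd_eq_zero hU hup hz, jd_eq_zero hU hup hz] at h
    simp [jvec] at h
    linarith
  have star' : ∀ z ∈ U, jd 0 (jd 4 Q) z + 2 * jd 2 Q z - jd 1 (jd 3 Q) z = 0 := fun z hz => by
    have h := star z hz
    rw [huq z hz, hup z hz] at h
    linarith
  have hY : ∀ z ∈ U, -(k - 1) * jd 1 Q z
      + z.2.2.2.1 * (-(k + 1) * jd 2 Q z - 3 * jd 1 (jd 3 Q) z + jd 0 (jd 4 Q) z) = 0 :=
    fun z hz => by
      have h := hQ.coeff_uxxxx hc hR hU hUp hz 0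
      rw [huq z hz, hup z hz] at h
      linear_combination h
  -- The p-derivative of `hY`, whose bracket does not depend on p. Subtracting p times it from `hY`
  -- leaves (k - 1)(Q_x - p Q_xp) up to sign.
  have hY' : ∀ z ∈ U, jd 0 (jd 4 Q) z - (k + 1) * jd 2 Q z - (k + 2) * jd 1 (jd 3 Q) z = 0 :=
    fun z hz => by
      have h := ((hasDerivAt_line hU (s 1) hz 3).const_mul (-(k - 1))).add
        ((hasDerivAt_line hU cp hz 3).mul ((((hasDerivAt_line hU (s 2) hz 3).const_mul
          (-(k + 1))).sub ((hasDerivAt_line hU (ss 1 3) hz 3).const_mul 3)).add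
            (hasDerivAt_line hU (ss 0 4) hz 3)))
      have h' := eq_zero_of_hasDerivAt_line hU hY hz 3 h
      rw [jd_ux, jd_comm hU (s 4) hz 3 0, jd_eq_zero hU hpq hz, jd_comm hU (s 3) hz 3 1,
        jd_eq_zero hU hpp hz, jd_comm hU hQ.1 hz 3 2, hup z hz, jd_comm hU hQ.1 hz 3 1] at h'
      simp only [zero_smul, add_zero, Pi.add_apply, Pi.sub_apply] at h'
      simp [jvec] at h'
      linarith
  refine ⟨huq, hup, huu, star', hY', fun z hz => ?_⟩
  have h1 := hY z hz
  have h2 := hY' z hz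
  have : (k - 1) * (jd 1 Q z - z.2.2.2.1 * jd 1 (jd 3 Q) z) = 0 := by
    linear_combination z.2.2.2.1 * h2 - h1
  exact (mul_eq_zero.1 this).resolve_left hk1

/-- The vanishing second-order derivatives of a multiplier that involve `x`. -/
theorem IsMultiplier.second_order_x (hk : 1 < k) (hc : 0 < c) (hR : 0 < R) (hU : IsOpen U)
    (hUp : U ⊆ posStrain) (hQ : IsMultiplier k c R U Q) :
    (∀ z ∈ U, jd 1 (jd 4 Q) z = 0) ∧ (∀ z ∈ U, jd 1 (jd 2 Q) z = 0) ∧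
    (∀ z ∈ U, jd 1 (jd 1 (jd 3 Q)) z = 0) ∧ (∀ z ∈ U, jd 1 (jd 1 Q) z = 0) := by
  obtain ⟨-, hup, -, star, -, hx⟩ := hQ.second_order hk hc hR hU hUp
  have s := fun i => contDiffOn_jd hU hQ.1 i
  have ss := fun i j => contDiffOn_jd hU (s j) i
  have hpq := hQ.pq_eq_zero hc hR hU hUp
  have hqp : ∀ z ∈ U, jd 4 (jd 3 Q) z = 0 := fun z hz => by
    rw [jd_comm hU hQ.1 hz]; exact hpq z hz
  have hline : ∀ (z : FirstJet) (i : Fin 5), (jvec i).2.2.2.1 = 0 →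
      HasDerivAt (fun s : ℝ => (z + s • jvec i).2.2.2.1) 0 0 := fun z i hi => by
    have : (fun s : ℝ => (z + s • jvec i).2.2.2.1) = fun _ => z.2.2.2.1 := by
      funext s; simp [hi]
    rw [this]; exact hasDerivAt_const _ _
  have dx : ∀ z ∈ U, ∀ i, (jvec i).2.2.2.1 = 0 →
      jd i (jd 1 Q) z - z.2.2.2.1 * jd i (jd 1 (jd 3 Q)) z = 0 := by
    intro z hz i hi
    have h := (hasDerivAt_line hU (s 1) hz i).sub ((hline z i hi).mul
      (hasDerivAt_line hU (ss 1 3) hz i))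
    have h' := eq_zero_of_hasDerivAt_line hU hx hz i h
    simpa using h'
  have hxq : ∀ z ∈ U, jd 1 (jd 4 Q) z = 0 := fun z hz => by
    have h := dx z hz 4 rfl
    rw [jd_comm hU (s 3) hz 4 1, jd_eq_zero hU hqp hz, jd_comm hU hQ.1 hz 4 1] at h
    linarith
  have hxu : ∀ z ∈ U, jd 1 (jd 2 Q) z = 0 := fun z hz => by
    have h := dx z hz 2 rfl
    rw [jd_comm hU (s 3) hz 2 1, jd_eq_zero hU hup hz, jd_comm hU hQ.1 hz 2 1] at h
    linarith
  -- The x-derivative of Q_tq + 2 Q_u - Q_xp = 0, in which Q_xq and Q_xu already vanish.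
  have hxxp : ∀ z ∈ U, jd 1 (jd 1 (jd 3 Q)) z = 0 := fun z hz => by
    have h := ((hasDerivAt_line hU (ss 0 4) hz 1).add
      ((hasDerivAt_line hU (s 2) hz 1).const_mul 2)).sub (hasDerivAt_line hU (ss 1 3) hz 1)
    have h' := eq_zero_of_hasDerivAt_line hU star hz 1 h
    rw [jd_comm hU (s 4) hz 1 0, jd_eq_zero hU hxq hz, hxu z hz] at h'
    linarith
  refine ⟨hxq, hxu, hxxp, fun z hz => ?_⟩
  have h := dx z hz 1 rfl
  rw [hxxp z hz] at h
  linarith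

/-- The determining equations on jets of functions with `u_xx = u_xxxx = u_tt = 0`. -/
theorem IsMultiplier.eq_of_flat (hk : 1 < k) (hc : 0 < c) (hR : 0 < R) (hU : IsOpen U)
    (hUp : U ⊆ posStrain) (hQ : IsMultiplier k c R U Q) (hz : z ∈ U) (m : ℝ) :
    jd 0 (jd 0 Q) z + 2 * z.2.2.2.2 * jd 0 (jd 2 Q) z + 2 * m * jd 0 (jd 3 Q) z = 0 := by
  obtain ⟨huq, hup, huu, -, -, -⟩ := hQ.second_order hk hc hR hU hUp
  obtain ⟨hxq, hxu, -, hxx⟩ := hQ.second_order_x hk hc hR hU hUp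
  have hqq := hQ.qq_eq_zero hc hR hU hUp
  have hpp := hQ.pp_eq_zero hc hR hU hUp
  obtain ⟨t₀, x₀, u₀, p, q⟩ := z
  have e := hQ.euler_testFun hU hUp hz rfl (r := 0) (y := 0) (m := m) (h := 0)
  have h2 : ∀ z ∈ U, dirD p m (dirD p m Q) z = 0 := by
    intro z hz
    have hd : ∀ i, jd i (dirD p m Q) z = dirD p m (jd i Q) z := fun i => jd_dirD hU hQ.1 hz i
    rw [dirD, hd, hd, hd]
    simp only [dirD]
    rw [hxx z hz, jd_comm hU hQ.1 hz 2 1, jd_comm hU hQ.1 hz 4 1, hxu z hz, hxq z hz, huu z hz,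
      jd_comm hU hQ.1 hz 4 2, huq z hz, hqq z hz]
    ring
  have h4 := dirD_eq_zero (p := p) (m := m) hU (dirD_eq_zero (p := p) (m := m) hU h2)
  rw [iteratedDeriv_two_testCurve hU hQ.1 hz, iteratedDeriv_four_testCurve hU hQ.1 hz,
    h2 _ hz, h4 _ hz] at e
  have f0 : waveF k c R p 0 0 0 = 0 := by simp [waveF]
  have g0 : waveFp k c R p 0 0 0 = 0 := by simp [waveFp]
  have s0 : waveFs k c R p 0 = 0 := by simp [waveFs]
  rw [f0, g0, s0, jd_comm hU hQ.1 hz 2 0, jd_comm hU hQ.1 hz 3 0, huu _ hz, hup _ hz, hpp _ hz,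
    jd_comm hU hQ.1 hz 3 2, hup _ hz] at e
  dsimp only
  linear_combination e

/-- At y = m = h = 0 the determining equation is a constant plus odd terms in r. The linear term
comes from c² p^(k-1) u_xx alone and the cubic one from the dispersive part of F. The linear
coefficient scales differently in x from the coefficient of u_xxxx, which makes k appear instead of
k + 2. -/
theorem IsMultiplier.coeff_uxx (hk : 1 < k) (hc : 0 < c) (hR : 0 < R) (hU : IsOpen U)
    (hUp : U ⊆ posStrain) (hQ : IsMultiplier k c R U Q) (hz : z ∈ U) :
    jd 0 (jd 4 Q) z - (k + 1) * jd 2 Q z - k * jd 1 (jd 3 Q) z = 0 := by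
  obtain ⟨huq, hup, huu, -, -, hx⟩ := hQ.second_order hk hc hR hU hUp
  obtain ⟨-, hxu, hxxp, hxx⟩ := hQ.second_order_x hk hc hR hU hUp
  have hqq := hQ.qq_eq_zero hc hR hU hUp
  have hpp := hQ.pp_eq_zero hc hR hU hUp
  have s := fun i => contDiffOn_jd hU hQ.1 i
  have ss := fun i j => contDiffOn_jd hU (s j) i
  have hflat := hQ.eq_of_flat hk hc hR hU hUp hz 0
  obtain ⟨t₀, x₀, u₀, p, q⟩ := z
  have hp : 0 < p := hUp hz
  have hder : ∀ r : ℝ,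
      iteratedDeriv 2 (fun x => Q (testCurve t₀ x₀ u₀ p q r 0 0 x)) x₀
        = r * (2 * jd 1 (jd 3 Q) (t₀, x₀, u₀, p, q) + jd 2 Q (t₀, x₀, u₀, p, q)) ∧
      iteratedDeriv 3 (fun x => Q (testCurve t₀ x₀ u₀ p q r 0 0 x)) x₀ = 0 ∧
      iteratedDeriv 4 (fun x => Q (testCurve t₀ x₀ u₀ p q r 0 0 x)) x₀ = 0 := by
    intro r
    set j := testCurve t₀ x₀ u₀ p q r 0 0 with hj
    have hj0 : j x₀ = (t₀, x₀, u₀, p, q) := testCurve_self ..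
    have hev : ∀ᶠ x in 𝓝 x₀, j x ∈ U := eventually_testCurve_mem hU hz
    have d : ∀ {B : FirstJet → ℝ}, ContDiffOn ℝ ∞ B U → ∀ x, j x ∈ U →
        HasDerivAt (fun x => B (j x)) (jd 1 B (j x) + (p + r * (x - x₀)) * jd 2 B (j x)
          + r * jd 3 B (j x)) x := fun hB x hx =>
      (hasDerivAt_comp_testCurve hU hB hx).congr_deriv (by simp [hj])
    have e1 : deriv (fun x => Q (j x)) =ᶠ[𝓝 x₀] fun x => jd 1 Q (j x)
        + (p + r * (x - x₀)) * jd 2 Q (j x) + r * jd 3 Q (j x) :=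
      hev.mono fun x hx => (d hQ.1 x hx).deriv
    have e2 : deriv (deriv fun x => Q (j x)) =ᶠ[𝓝 x₀] fun x =>
        r * (2 * jd 1 (jd 3 Q) (j x) + jd 2 Q (j x)) := by
      filter_upwards [hev, e1.deriv] with x hx h'
      rw [h']
      refine ((((d (s 1) x hx).add ((((hasDerivAt_sub x₀ x).const_mul r).const_add p).mul
        (d (s 2) x hx))).add ((d (s 3) x hx).const_mul r)).congr_deriv ?_).deriv
      rw [hxx _ hx, jd_comm hU hQ.1 hx 2 1, jd_comm hU hQ.1 hx 3 1, jd_comm hU hQ.1 hx 3 2,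
        hxu _ hx, huu _ hx, hup _ hx, hpp _ hx]
      ring
    have e3 : deriv (deriv (deriv fun x => Q (j x))) =ᶠ[𝓝 x₀] fun _ => 0 := by
      filter_upwards [hev, e2.deriv] with x hx h'
      rw [h']
      refine ((((d (ss 1 3) x hx).const_mul 2).add (d (s 2) x hx)).const_mul r |>.congr_deriv
        ?_).deriv
      rw [hxxp _ hx, jd_comm hU (s 3) hx 2 1, jd_eq_zero hU hup hx, jd_comm hU (s 3) hx 3 1,
        jd_eq_zero hU hpp hx, hxu _ hx, huu _ hx, jd_comm hU hQ.1 hx 3 2, hup _ hx]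
      ring
    refine ⟨?_, ?_, ?_⟩
    · rw [iteratedDeriv_succ', iteratedDeriv_one, e2.eq_of_nhds, hj0]
    · rw [iteratedDeriv_succ', iteratedDeriv_succ', iteratedDeriv_one, e3.eq_of_nhds]
    · rw [iteratedDeriv_succ', iteratedDeriv_succ', iteratedDeriv_succ', iteratedDeriv_one,
        e3.deriv_eq, deriv_const]
  have e := fun r : ℝ => hQ.euler_testFun hU hUp hz rfl (r := r) (y := 0) (m := 0) (h := 0)
  simp only [iteratedDeriv_one_testCurve hU hQ.1 hz, (hder _).1, (hder _).2.1, (hder _).2.2, dirD,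
    huu _ hz, hup _ hz, hpp _ hz, huq _ hz, hqq _ hz, jd_comm hU hQ.1 hz 2 0] at e
  have hx' := hx _ hz
  dsimp only at hflat hx' ⊢
  set P := p ^ (k - 3) with hPdef
  have hP : 0 < P := Real.rpow_pos_of_pos hp _
  have r1 : p ^ (k - 1) = P * p ^ 2 := by
    rw [hPdef, ← Real.rpow_add_natCast hp.ne']; push_cast; ring_nf
  have r2 : p ^ (k - 2) = P * p := by
    rw [hPdef, ← Real.rpow_add_one hp.ne']; ring_nf
  have e1 := e 1
  have e2 := e 2
  simp only [waveF, waveFp, waveFr, waveFs, ← hPdef, r1, r2] at e1 e2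
  have hc' : 6 * c ^ 2 * P * p ^ 2 ≠ 0 := by positivity
  refine eq_zero_of_mul_left_eq_zero hc' ?_
  rw [sub_eq_zero] at hx'
  rw [hx'] at e1 e2
  -- The weights 8 and -1 at r = 1 and r = 2 remove the cubic part and leave 6 times the linear one;
  -- the constant part, taken 8 - 1 = 7 times, is `hflat`.
  linear_combination 8 * e1 - e2 - 7 * hflat

/-- All second-order derivatives of a multiplier and its derivatives in `x` and `u` vanish. -/
theorem IsMultiplier.jd_jd_eq_zero (hk : 1 < k) (hc : 0 < c) (hR : 0 < R) (hU : IsOpen U)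
    (hUp : U ⊆ posStrain) (hQ : IsMultiplier k c R U Q) :
    (∀ z ∈ U, jd 1 Q z = 0) ∧ (∀ z ∈ U, jd 2 Q z = 0) ∧ ∀ i j, ∀ z ∈ U, jd i (jd j Q) z = 0 := by
  obtain ⟨-, -, -, star, hY, hx⟩ := hQ.second_order hk hc hR hU hUp
  have hqq := hQ.qq_eq_zero hc hR hU hUp
  have hpp := hQ.pp_eq_zero hc hR hU hUp
  have hpq := hQ.pq_eq_zero hc hR hU hUp
  -- The equations from u_xxxx and from u_xx differ by exactly 2 Q_xp.
  have hxp : ∀ z ∈ U, jd 1 (jd 3 Q) z = 0 := fun z hz => by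
    linarith [hY z hz, hQ.coeff_uxx hk hc hR hU hUp hz]
  have hX : ∀ z ∈ U, jd 1 Q z = 0 := fun z hz => by
    have := hx z hz; rw [hxp z hz] at this; linarith
  have hu : ∀ z ∈ U, jd 2 Q z = 0 := fun z hz => by
    have h1 := star z hz
    have h2 := hY z hz
    rw [hxp z hz] at h1 h2
    refine eq_zero_of_mul_left_eq_zero (a := k + 3) (by linarith) ?_
    linear_combination h1 - h2
  have htq : ∀ z ∈ U, jd 0 (jd 4 Q) z = 0 := fun z hz => by
    have h1 := star z hz
    rw [hxp z hz, hu z hz] at h1; linarith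
  have htp : ∀ z ∈ U, jd 0 (jd 3 Q) z = 0 := fun z hz => by
    linarith [hQ.eq_of_flat hk hc hR hU hUp hz 1, hQ.eq_of_flat hk hc hR hU hUp hz 0]
  have htt : ∀ z ∈ U, jd 0 (jd 0 Q) z = 0 := fun z hz => by
    have h1 := hQ.eq_of_flat hk hc hR hU hUp hz 0
    rw [jd_eq_zero hU hu hz] at h1; linarith
  refine ⟨hX, hu, ?_⟩
  have key : ∀ i j : Fin 5, i ≤ j → ∀ z ∈ U, jd i (jd j Q) z = 0 := by
    intro i j hij z hz
    have h1 : ∀ i, jd i (jd 1 Q) z = 0 := jd_eq_zero hU hX hz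
    have h2 : ∀ i, jd i (jd 2 Q) z = 0 := jd_eq_zero hU hu hz
    have h1' : ∀ i, jd 1 (jd i Q) z = 0 := fun i => by rw [jd_comm hU hQ.1 hz, h1]
    have h2' : ∀ i, jd 2 (jd i Q) z = 0 := fun i => by rw [jd_comm hU hQ.1 hz, h2]
    fin_cases i <;> fin_cases j <;>
      first
      | exact htt z hz | exact htp z hz | exact htq z hz | exact hpp z hz | exact hpq z hz
      | exact hqq z hz | exact h1 _ | exact h2 _ | exact h1' _ | exact h2' _
      | exact absurd hij (by decide)
  intro i j z hz
  rcases le_total i j with hij | hij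
  · exact key i j hij z hz
  · rw [jd_comm hU hQ.1 hz]; exact key j i hij z hz

theorem fderiv_eq_zero_of_jd {A : FirstJet → ℝ} (h : ∀ i, jd i A z = 0) : fderiv ℝ A z = 0 := by
  refine ContinuousLinearMap.ext fun v => ?_
  obtain ⟨a, b, c, d, e⟩ := v
  rw [fderiv_apply_eq_sum_jd]; simp [h]

/-- Every multiplier is a linear combination of `1, t, -u_x, u_t`. -/
theorem IsMultiplier.exists_eq_sum (hk : 1 < k) (hc : 0 < c) (hR : 0 < R) (hU : IsOpen U)
    (hUc : IsConnected U) (hUp : U ⊆ posStrain) (hQ : IsMultiplier k c R U Q) :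
    ∃ a : Fin 4 → ℝ, ∀ z ∈ U, Q z = ∑ i, a i * mult i z := by
  obtain ⟨hx, hu, h2⟩ := hQ.jd_jd_eq_zero hk hc hR hU hUp
  -- Connectedness of U is needed here; it makes Q_t, Q_p, Q_q constant, and afterwards the
  -- difference of Q and its linear part.
  have const : ∀ {A : FirstJet → ℝ}, ContDiffOn ℝ ∞ A U → (∀ z ∈ U, ∀ i, jd i A z = 0) →
      ∃ a, ∀ z ∈ U, A z = a := fun hA h =>
    hU.exists_is_const_of_fderiv_eq_zero hUc.isPreconnected (hA.differentiableOn (by simp))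
      fun z hz => fderiv_eq_zero_of_jd (h z hz)
  have hs := fun i => contDiffOn_jd hU hQ.1 i
  obtain ⟨a₁, h₁⟩ := const (hs 0) fun z hz i => h2 i 0 z hz
  obtain ⟨a₂, h₂⟩ := const (hs 3) fun z hz i => h2 i 3 z hz
  obtain ⟨a₃, h₃⟩ := const (hs 4) fun z hz i => h2 i 4 z hz
  have hlin : ContDiffOn ℝ ∞ (fun z : FirstJet => a₁ * z.1 + a₂ * z.2.2.2.1 + a₃ * z.2.2.2.2) U :=
    ContDiff.contDiffOn (by fun_prop)
  obtain ⟨a₀, h₀⟩ := const (hQ.1.sub hlin) fun z hz i => by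
    refine (hasDerivAt_line hU (hQ.1.sub hlin) hz i).unique ?_
    have h := (hasDerivAt_line hU hQ.1 hz i).sub
      (((((hasDerivAt_id (0 : ℝ)).mul_const (jvec i).1).const_add z.1).const_mul a₁).add
        ((((hasDerivAt_id (0 : ℝ)).mul_const (jvec i).2.2.2.1).const_add z.2.2.2.1).const_mul a₂)
        |>.add
        ((((hasDerivAt_id (0 : ℝ)).mul_const (jvec i).2.2.2.2).const_add z.2.2.2.2).const_mul a₃))
    refine h.congr_deriv ?_
    have e1 := hx z hz
    have e2 := hu z hz
    have e3 := h₁ z hz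
    have e4 := h₂ z hz
    have e5 := h₃ z hz
    fin_cases i <;> simp [jvec] <;> linarith
  -- The sign of a₂ changes because the third multiplier is -u_x.
  refine ⟨![a₀, a₁, -a₂, a₃], fun z hz => ?_⟩
  have := h₀ z hz
  simp [Fin.sum_univ_four, mult] at this ⊢
  linarith

end Deductions

end HNWave

end

/-! ### The theorem -/

theorem mainTheorem7 (k c R : ℝ) (hk : 1 < k) (hc : 0 < c) (hR : 0 < R) :
    -- the first-order multipliers are exactly the linear combinations of `1, t, -u_x, u_t`,
    -- which are linearly independent
    (∀ U : Set HNWave.FirstJet, IsOpen U → IsConnected U → U ⊆ HNWave.posStrain →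
      (∀ Q : HNWave.FirstJet → ℝ, HNWave.IsMultiplier k c R U Q ↔
        ∃ a : Fin 4 → ℝ, ∀ z ∈ U, Q z = ∑ i, a i * HNWave.mult i z) ∧
      (∀ a : Fin 4 → ℝ, (∀ z ∈ U, ∑ i, a i * HNWave.mult i z = 0) → a = 0)) ∧
    -- the multiplier of `Tᵢ` is `Qᵢ = ∂Tᵢ/∂u_t`
    (∀ (i : Fin 4) (t x u p r q : ℝ), 0 < p →
      HasDerivAt (fun q' => HNWave.density k c R i t u p r q')
        (HNWave.mult i (t, x, u, p, q)) q) ∧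
    (∀ (O : Set (ℝ × ℝ)) (u : ℝ → ℝ → ℝ), HNWave.SmoothOn HNWave.posStrain O u →
      -- characteristic form, for arbitrary functions `u` of positive strain
      (∀ (i : Fin 4) (t x : ℝ), (t, x) ∈ O →
        HNWave.Dt (HNWave.densityOn k c R i u) t x + HNWave.Dx (HNWave.fluxOn k c R i u) t x
          = HNWave.waveOp k c R u t x * HNWave.mult i (HNWave.firstJet u t x)) ∧
      -- local and global continuity equations, for solutions `u`
      ((∀ t x : ℝ, (t, x) ∈ O → HNWave.waveOp k c R u t x = 0) →
        (∀ (i : Fin 4) (t x : ℝ), (t, x) ∈ O →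
          HNWave.Dt (HNWave.densityOn k c R i u) t x
            + HNWave.Dx (HNWave.fluxOn k c R i u) t x = 0) ∧
        (∀ (i : Fin 4) (t a b : ℝ), a ≤ b → (∀ x ∈ Set.Icc a b, (t, x) ∈ O) →
          HasDerivAt (fun s => ∫ x in a..b, HNWave.densityOn k c R i u s x)
            (-(HNWave.fluxOn k c R i u t b - HNWave.fluxOn k c R i u t a)) t)) ∧
      -- `T₄` is the Hamiltonian density in `v = u_x`, `w = -u_t`, and the wave equation is
      -- Hamilton's system for it
      (∀ t x : ℝ, (t, x) ∈ O →
        HNWave.densityOn k c R 3 u t x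
            = HNWave.hamiltonian k c R (-HNWave.pd 1 0 u t x) (HNWave.pd 0 1 u t x)
                (HNWave.Dx (HNWave.pd 0 1 u) t x) ∧
        (HNWave.waveOp k c R u t x = 0 ↔
          HNWave.HamiltonEqs k c R (fun s y => -HNWave.pd 1 0 u s y) (HNWave.pd 0 1 u) t x))) := by
  refine ⟨fun U hU hUc hUp => ⟨fun Q => ⟨fun hQ => hQ.exists_eq_sum hk hc hR hU hUc hUp,
    fun ⟨_, ha⟩ => HNWave.isMultiplier_of_eq_sum hk hUp ha⟩,
      fun _ ha => HNWave.mult_linearIndependent hU hUc.nonempty ha⟩,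
    fun i t x u p r q _ => HNWave.hasDerivAt_density_mult i t x u p r q, ?_⟩
  rintro O u ⟨hO, hu, hp⟩
  have hu' : HNWave.Sm O u := hu
  have hp' : ∀ t x, (t, x) ∈ O → 0 < HNWave.pd 0 1 u t x := hp
  have hchar : ∀ (i : Fin 4) (t x : ℝ), (t, x) ∈ O →
      HNWave.Dt (HNWave.densityOn k c R i u) t x + HNWave.Dx (HNWave.fluxOn k c R i u) t x
        = HNWave.waveOp k c R u t x * HNWave.mult i (HNWave.firstJet u t x) := fun i t x h =>
    HNWave.Dt_densityOn_add_Dx_fluxOn hk hO hu' h (hp' t x h) i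
  refine ⟨hchar, fun hsol => ?_, fun t x h => ⟨HNWave.densityOn_three_eq_hamiltonian,
    HNWave.waveOp_eq_zero_iff_hamiltonEqs hk hO hu' hp' h⟩⟩
  have hcons : ∀ (i : Fin 4) (t x : ℝ), (t, x) ∈ O →
      HNWave.Dt (HNWave.densityOn k c R i u) t x + HNWave.Dx (HNWave.fluxOn k c R i u) t x = 0 :=
    fun i t x h => by rw [hchar i t x h, hsol t x h, zero_mul]
  exact ⟨hcons, fun i t a b hab h => HNWave.hasDerivAt_integral_of_continuity hO
    (hu'.densityOn hO hp' i) (hu'.fluxOn hO hp' i) (hcons i) hab h⟩
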